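/- Let $\Sigma$ be a connected, paracompact, Hausdorff real analytic manifold of dimension $d$, and let $G$ be a connected compact (finite-dimensional) Lie group. *Curves and paths.* A curve is a continuous map $c:[0,1]\to\Sigma$ with source $s(c)=c(0)$ and range $r(c)=c(1)$ such that for some partition $0=t_0<\dots<t_n=1$ each restriction $c|_{[t_k,t_{k+1}]}$ is either constant or analytic on the closed interval $[t_k,t_{k+1}]$ and an embedding (injective immersion, homeomorphism onto its image) on the open interval $]t_k,t_{k+1}[$. If $s(c_2)=r(c_1)$, then $c_2c_1$ is the curve that runs through $c_1$ on $[0,\frac12]$ and then through $c_2$ on $[\frac12,1]$; $c^{-1}(t)=c(1-t)$. Two curves with the same source and range are equivalent if they coincide up to finitely many retracings $c^{-1}c$ and a reparametrization, i.e. composition with an increasing homeomorphism of $[0,1]$ which is analytic with positive derivative on the open intervals of some partition of $[0,1]$. The equivalence classes, called paths, are the arrows of a groupoid $\mathcal P$ whose objects are the points of $\Sigma$. *Edges and tame subgroupoids.* An edge is the class of a curve that is analytic on $[0,1]$ and an embedding on $]0,1[$; the image of the edge is the image of such a curve. A finite set of edges is independent if for any two distinct edges of the set every common point of their images is an endpoint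 (source or range) of both. Let $\mathcal L$ be the set of subgroupoids of $\mathcal P$ generated by (finite) independent sets of edges. *Connections.* Let $\bar{\mathcal A}=\mathrm{Hom}[\mathcal P,G]$ be the set of all maps $\bar A:\mathcal P\to G$ with $\bar A(p'p)=\bar A(p')\bar A(p)$ and $\bar A(p^{-1})=\bar A(p)^{-1}$, with the weakest topology such that all maps $\bar A\mapsto\bar A(p)$, $p\in\mathcal P$, are continuous (a compact Hausdorff space). For $L\in\mathcal L$ let $\mathcal A_L=\mathrm{Hom}[L,G]$, which an independent set $\{e_1,\dots,e_n\}$ of generators of $L$ identifies with $G^n$ by $A\mapsto(A(e_1),\dots,A(e_n))$; this gives $\mathcal A_L$ its topology and its manifold structure. Let $p_L:\bar{\mathcal A}\to\mathcal A_L$ be the restriction map and $p_L^*$ the pull-back of functions. **Proposition.** The set of cylindrical functions $\mathrm{Cyl}(\bar{\mathcal A})=\bigcup_{L\in\mathcal L}p_L^*C(\mathcal A_L)$ is a unital $*$-subalgebra of the algebra $C(\bar{\mathcal A})$ of continuous complex functions on $\bar{\mathcal A}$, and it is dense in $C(\bar{\mathcal A})$ for the supremum norm. For every $k\in\{1,2,\dots\}\cup\{\infty\}$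 the set $\mathrm{Cyl}^k(\bar{\mathcal A})=\bigcup_{L\in\mathcal L}p_L^*C^k(\mathcal A_L)$ is a unital $*$-subalgebra of $\mathrm{Cyl}(\bar{\mathcal A})$, and it too is dense in $C(\bar{\mathcal A})$ for the supremum norm. -/

import Mathlib

open scoped Manifold ContDiff
open CategoryTheory

noncomputable section

namespace GenConn

universe u v

/-! ### Piecewise analytic curves -/

/-- `Piecewise P`: there is a partition `0 = t₀ < t₁ < ⋯ < tₙ = 1` (`n ≥ 1`) such that `P tₖ tₖ₊₁`
holds for every `k`. (The transitive closure runs over the chains of consecutive nodes.) -/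
def Piecewise (P : ℝ → ℝ → Prop) : Prop :=
  Relation.TransGen (fun a b => 0 ≤ a ∧ a < b ∧ b ≤ 1 ∧ P a b) 0 1

/-- `f` is analytic on the closed interval `[a,b]` and its restriction to the open interval
`]a,b[` is an embedding (an injective immersion which is a homeomorphism onto its image), so that
the image of the open interval is an embedded one-dimensional submanifold. -/
structure IsAnalyticArc (d : ℕ) {M : Type u} [TopologicalSpace M]
    [ChartedSpace (EuclideanSpace ℝ (Fin d)) M] (f : ℝ → M) (a b : ℝ) : Prop where
  analytic : ContMDiffOn 𝓘(ℝ, ℝ) (𝓡 d) ω f (Set.Icc a b)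
  immersion : ∀ t ∈ Set.Ioo a b, mfderiv 𝓘(ℝ, ℝ) (𝓡 d) f t ≠ 0
  embedding : Topology.IsEmbedding ((Set.Ioo a b).domRestrict f)

/-- The admissible pieces of a curve: analytic arcs, and constant pieces (whose image is a
zero-dimensional submanifold). A constant piece is a retracing, so it is removed by the
equivalence relation on curves below; it only serves to represent the identity paths. -/
def IsPiece (d : ℕ) {M : Type u} [TopologicalSpace M]
    [ChartedSpace (EuclideanSpace ℝ (Fin d)) M] (f : ℝ → M) (a b : ℝ) : Prop :=
  IsAnalyticArc d f a b ∨ ∀ t ∈ Set.Icc a b, f t = f a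

section Curves

variable (d : ℕ) {M : Type u} [TopologicalSpace M] [ChartedSpace (EuclideanSpace ℝ (Fin d)) M]

/-- Continuous, piecewise analytic parametrized curves `[0,1] → M` with source `x`, range `y`. -/
def Curve (x y : M) : Type u :=
  {c : Path x y // Piecewise (IsPiece d c.extend)}

variable {d}

theorem IsAnalyticArc.comp_affine {f g : ℝ → M} {a b : ℝ} (k l : ℝ) (hk : k ≠ 0)
    (a' b' : ℝ) (hI : Set.MapsTo (fun t => k * t + l) (Set.Icc a' b') (Set.Icc a b))
    (hO : Set.MapsTo (fun t => k * t + l) (Set.Ioo a' b') (Set.Ioo a b))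
    (hg : ∀ t ∈ Set.Icc a' b', g t = f (k * t + l))
    (h : IsAnalyticArc d f a b) : IsAnalyticArc d g a' b' := by
  have hA : ContMDiff 𝓘(ℝ, ℝ) 𝓘(ℝ, ℝ) ω (fun t : ℝ => k * t + l) := by
    rw [contMDiff_iff_contDiff]; fun_prop
  refine ⟨?_, ?_, ?_⟩
  · exact (h.analytic.comp hA.contMDiffOn hI).congr hg
  · intro t ht
    have hev : g =ᶠ[nhds t] (f ∘ fun t => k * t + l) := by
      filter_upwards [Ioo_mem_nhds ht.1 ht.2] with s hs
      exact hg s ⟨hs.1.le, hs.2.le⟩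
    rw [hev.mfderiv_eq]
    have hft : MDifferentiableAt 𝓘(ℝ, ℝ) (𝓡 d) f (k * t + l) :=
      (h.analytic.contMDiffAt (Icc_mem_nhds (hO ht).1 (hO ht).2)).mdifferentiableAt (by simp)
    have hAt : HasFDerivAt (fun t : ℝ => k * t + l)
        (ContinuousLinearMap.toSpanSingleton ℝ k) t := by
      have := ((hasDerivAt_id t).const_mul k).add_const l
      simpa using this.hasFDerivAt
    have hc := (HasMFDerivAt.comp t hft.hasMFDerivAt hAt.hasMFDerivAt).mfderiv
    intro h0
    apply h.immersion _ (hO ht)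
    have h1 := hc.symm.trans h0
    refine ContinuousLinearMap.ext fun (v : ℝ) => ?_
    have h2 : (ContinuousLinearMap.toSpanSingleton ℝ k) (k⁻¹ * v : ℝ) = v := by
      simp only [ContinuousLinearMap.toSpanSingleton_apply, smul_eq_mul]
      field_simp
    exact (congrArg (mfderiv 𝓘(ℝ, ℝ) (𝓡 d) f (k * t + l)) h2).symm.trans
      (DFunLike.congr_fun h1 (k⁻¹ * v : ℝ))
  · have hcomp : (Set.Ioo a' b').domRestrict g = (Set.Ioo a b).domRestrict f ∘ hO.restrict := by
      funext t
      exact hg t.1 ⟨t.2.1.le, t.2.2.le⟩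
    rw [hcomp]
    refine h.embedding.comp ?_
    have hh : Topology.IsEmbedding (fun t : ℝ => k * t + l) :=
      (affineHomeomorph k l hk).isEmbedding
    exact hh.restrict hO

theorem IsPiece.comp_affine {f g : ℝ → M} {a b : ℝ} (k l : ℝ) (hk : k ≠ 0)
    (a' b' : ℝ) (hI : Set.MapsTo (fun t => k * t + l) (Set.Icc a' b') (Set.Icc a b))
    (hO : Set.MapsTo (fun t => k * t + l) (Set.Ioo a' b') (Set.Ioo a b)) (hab : a' < b')
    (hg : ∀ t ∈ Set.Icc a' b', g t = f (k * t + l))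
    (h : IsPiece d f a b) : IsPiece d g a' b' := by
  rcases h with h | h
  · exact Or.inl (h.comp_affine k l hk a' b' hI hO hg)
  · refine Or.inr fun t ht => ?_
    have ha : a' ∈ Set.Icc a' b' := ⟨le_rfl, hab.le⟩
    rw [hg t ht, hg a' ha, h _ (hI ht), h _ (hI ha)]

/-- The constant curve. -/
def Curve.refl (x : M) : Curve d x x :=
  ⟨Path.refl x, .single ⟨le_rfl, one_pos, le_rfl, Or.inr fun _ _ => rfl⟩⟩

/-- The reversed curve `c⁻¹(t) = c(1-t)`. -/
def Curve.symm {x y : M} (c : Curve d x y) : Curve d y x :=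
  ⟨c.1.symm, by
    have h := Relation.TransGen.swap (r := fun a b => 0 ≤ a ∧ a < b ∧ b ≤ 1 ∧
        IsPiece d c.1.extend a b) 1 0 c.2
    have h2 := Relation.TransGen.lift (r := Function.swap
        (fun a b => 0 ≤ a ∧ a < b ∧ b ≤ 1 ∧ IsPiece d c.1.extend a b))
      (p := fun a b => 0 ≤ a ∧ a < b ∧ b ≤ 1 ∧ IsPiece d c.1.symm.extend a b)
      (fun t : ℝ => 1 - t) ?_ 1 0 h
    · simpa [Piecewise, Function.onFun] using h2
    · rintro b a ⟨h0, h1, h2, h3⟩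
      refine ⟨by linarith, by linarith, by linarith, ?_⟩
      refine h3.comp_affine (-1) 1 (by norm_num) _ _ ?_ ?_ (by linarith) ?_
      · intro t ht; constructor <;> linarith [ht.1, ht.2]
      · intro t ht; constructor <;> linarith [ht.1, ht.2]
      · intro t _
        rw [Path.extend_symm_apply]
        congr 1; ring⟩

/-- The composition of curves: first `c₁` (run through on `[0,1/2]`), then `c₂` (on `[1/2,1]`). -/
def Curve.trans {x y z : M} (c₁ : Curve d x y) (c₂ : Curve d y z) : Curve d x z :=
  ⟨c₁.1.trans c₂.1, by
    have h1 := Relation.TransGen.lift (r := fun a b => 0 ≤ a ∧ a < b ∧ b ≤ 1 ∧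
        IsPiece d c₁.1.extend a b)
      (p := fun a b => 0 ≤ a ∧ a < b ∧ b ≤ 1 ∧ IsPiece d (c₁.1.trans c₂.1).extend a b)
      (fun t : ℝ => t / 2) ?_ 0 1 c₁.2
    · have h2 := Relation.TransGen.lift (r := fun a b => 0 ≤ a ∧ a < b ∧ b ≤ 1 ∧
          IsPiece d c₂.1.extend a b)
        (p := fun a b => 0 ≤ a ∧ a < b ∧ b ≤ 1 ∧ IsPiece d (c₁.1.trans c₂.1).extend a b)
        (fun t : ℝ => (t + 1) / 2) ?_ 0 1 c₂.2
      · refine Relation.TransGen.trans (b := 1 / 2) ?_ ?_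
        · simpa [Function.onFun] using h1
        · simpa [Function.onFun] using h2
      · rintro a b ⟨h0, h1, h2, h3⟩
        refine ⟨by linarith, by linarith, by linarith, ?_⟩
        refine h3.comp_affine 2 (-1) (by norm_num) _ _ ?_ ?_ (by linarith) ?_
        · intro t ht; constructor <;> linarith [ht.1, ht.2]
        · intro t ht; constructor <;> linarith [ht.1, ht.2]
        · intro t ht
          rw [Path.extend_trans_of_half_le _ _ (by linarith [ht.1])]
          congr 1
    · rintro a b ⟨h0, h1, h2, h3⟩
      refine ⟨by linarith, by linarith, by linarith, ?_⟩
      refine h3.comp_affine 2 0 (by norm_num) _ _ ?_ ?_ (by linarith) ?_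
      · intro t ht; constructor <;> linarith [ht.1, ht.2]
      · intro t ht; constructor <;> linarith [ht.1, ht.2]
      · intro t ht
        rw [Path.extend_trans_of_le_half _ _ (by linarith [ht.2])]
        congr 1; ring⟩

end Curves

/-! ### Equivalence of curves and the groupoid of paths -/

/-- Orientation preserving piecewise analytic diffeomorphisms `φ : [0,1] → [0,1]`: continuous,
fixing `0` and `1`, and, for some partition of `[0,1]`, analytic with positive derivative on each
of the open intervals of the partition. (Such a `φ` is an increasing homeomorphism of `[0,1]`.) -/
structure IsReparametrization (φ : ℝ → ℝ) : Prop where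
  continuousOn : ContinuousOn φ (Set.Icc 0 1)
  map_zero : φ 0 = 0
  map_one : φ 1 = 1
  piecewise : Piecewise fun a b =>
    ContDiffOn ℝ ω φ (Set.Ioo a b) ∧ ∀ t ∈ Set.Ioo a b, 0 < deriv φ t

section Groupoid

variable {d : ℕ} {M : Type u} [TopologicalSpace M] [ChartedSpace (EuclideanSpace ℝ (Fin d)) M]

/-- Two curves with the same source and range are equivalent if they coincide up to a
reparametrization and finitely many retracings (curves of the form `d · d⁻¹`, with `d` first):
the smallest equivalence relation which is compatible with composition, identifies `c ∘ φ`
with `c`, and allows to remove a retracing before or after a curve. -/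
inductive CurveEquiv : {x y : M} → Curve d x y → Curve d x y → Prop
  | refl {x y : M} (c : Curve d x y) : CurveEquiv c c
  | symm {x y : M} {c c' : Curve d x y} : CurveEquiv c c' → CurveEquiv c' c
  | trans {x y : M} {c c' c'' : Curve d x y} :
      CurveEquiv c c' → CurveEquiv c' c'' → CurveEquiv c c''
  | comp {x y z : M} {a a' : Curve d x y} {b b' : Curve d y z} :
      CurveEquiv a a' → CurveEquiv b b' → CurveEquiv (a.trans b) (a'.trans b')
  | reparam {x y : M} (c c' : Curve d x y) (φ : ℝ → ℝ) : IsReparametrization φ →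
      (∀ t ∈ Set.Icc (0 : ℝ) 1, c'.1.extend t = c.1.extend (φ t)) → CurveEquiv c' c
  | retrace_before {x y z : M} (e : Curve d x y) (c : Curve d x z) :
      CurveEquiv ((e.trans e.symm).trans c) c
  | retrace_after {x y z : M} (c : Curve d x y) (e : Curve d y z) :
      CurveEquiv (c.trans (e.trans e.symm)) c

theorem Curve.refl_trans_refl (x : M) :
    (Curve.refl (d := d) x).trans (Curve.refl x).symm = Curve.refl x :=
  Subtype.ext Path.refl_trans_refl

theorem CurveEquiv.refl_trans {x y : M} (c : Curve d x y) :
    CurveEquiv ((Curve.refl x).trans c) c := by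
  have h := CurveEquiv.retrace_before (Curve.refl x) c
  rwa [Curve.refl_trans_refl] at h

theorem CurveEquiv.trans_refl {x y : M} (c : Curve d x y) :
    CurveEquiv (c.trans (Curve.refl y)) c := by
  have h := CurveEquiv.retrace_after c (Curve.refl y)
  rwa [Curve.refl_trans_refl] at h

theorem CurveEquiv.trans_symm {x y : M} (c : Curve d x y) :
    CurveEquiv (c.trans c.symm) (Curve.refl x) :=
  (CurveEquiv.trans_refl _).symm.trans (CurveEquiv.retrace_before c (Curve.refl x))

theorem Curve.symm_symm {x y : M} (c : Curve d x y) : c.symm.symm = c :=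
  Subtype.ext (Path.symm_symm c.1)

theorem CurveEquiv.symm_trans {x y : M} (c : Curve d x y) :
    CurveEquiv (c.symm.trans c) (Curve.refl y) := by
  have h := CurveEquiv.trans_symm c.symm
  rwa [Curve.symm_symm] at h

/-- The change of parameter between `(c₁ c₂) c₃` and `c₁ (c₂ c₃)`. -/
def assocParam (t : ℝ) : ℝ :=
  if t ≤ 1 / 4 then 2 * t else if t ≤ 1 / 2 then t + 1 / 4 else (t + 1) / 2

theorem isReparametrization_assocParam : IsReparametrization assocParam := by
  have key : ∀ (a b k l : ℝ), 0 < k → (∀ t ∈ Set.Ioo a b, assocParam t = k * t + l) →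
      ContDiffOn ℝ ω assocParam (Set.Ioo a b) ∧
        ∀ t ∈ Set.Ioo a b, 0 < deriv assocParam t := by
    intro a b k l hk h
    constructor
    · refine ContDiffOn.congr (f := fun t => k * t + l) ?_ h
      fun_prop
    · intro t ht
      have hev : assocParam =ᶠ[nhds t] fun t => k * t + l := by
        filter_upwards [Ioo_mem_nhds ht.1 ht.2] with s hs using h s hs
      rw [hev.deriv_eq]
      have := (((hasDerivAt_id t).const_mul k).add_const l).deriv
      simp only [id, mul_one] at this
      rw [this]; exact hk
  refine ⟨Continuous.continuousOn ?_, by norm_num [assocParam], by norm_num [assocParam], ?_⟩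
  · unfold assocParam
    refine Continuous.if_le (by fun_prop) (Continuous.if_le (by fun_prop) (by fun_prop)
      (by fun_prop) (by fun_prop) ?_) (by fun_prop) (by fun_prop) ?_
    · intro t ht; rw [ht]; norm_num
    · intro t ht; rw [ht]; norm_num
  · refine ((Relation.TransGen.single (b := 1 / 4) ?_).tail (c := 1 / 2) ?_).tail (c := 1) ?_
    · refine ⟨le_rfl, by norm_num, by norm_num, key _ _ 2 0 (by norm_num) ?_⟩
      intro t ht
      simp only [assocParam, if_pos ht.2.le, add_zero]
    · refine ⟨by norm_num, by norm_num, by norm_num, key _ _ 1 (1 / 4) (by norm_num) ?_⟩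
      intro t ht
      simp only [assocParam, if_neg (not_le.2 ht.1), if_pos ht.2.le, one_mul]
    · refine ⟨by norm_num, by norm_num, by norm_num, key _ _ (1 / 2) (1 / 2) (by norm_num) ?_⟩
      intro t ht
      have h1 : ¬ t ≤ 1 / 4 := by linarith [ht.1]
      simp only [assocParam, if_neg h1, if_neg (not_le.2 ht.1)]
      ring

theorem CurveEquiv.assoc {w x y z : M} (a : Curve d w x) (b : Curve d x y) (c : Curve d y z) :
    CurveEquiv ((a.trans b).trans c) (a.trans (b.trans c)) := by
  refine CurveEquiv.reparam _ _ assocParam isReparametrization_assocParam ?_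
  rintro t -
  change ((a.1.trans b.1).trans c.1).extend t = (a.1.trans (b.1.trans c.1)).extend _
  unfold assocParam
  split_ifs with h1 h2
  · rw [Path.extend_trans_of_le_half _ _ (by linarith), Path.extend_trans_of_le_half _ _
      (by linarith), Path.extend_trans_of_le_half _ _ (by linarith)]
  · rw [Path.extend_trans_of_le_half _ _ (by linarith), Path.extend_trans_of_half_le _ _
      (by linarith), Path.extend_trans_of_half_le _ _ (by linarith),
      Path.extend_trans_of_le_half _ _ (by linarith)]
    congr 1; ring
  · rw [Path.extend_trans_of_half_le _ _ (by linarith), Path.extend_trans_of_half_le _ _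
      (by linarith), Path.extend_trans_of_half_le _ _ (by linarith)]
    congr 1; ring

theorem CurveEquiv.symm_congr {x y : M} {c c' : Curve d x y} (h : CurveEquiv c c') :
    CurveEquiv c.symm c'.symm :=
  ((CurveEquiv.trans_refl _).symm.trans
    ((CurveEquiv.refl c.symm).comp (CurveEquiv.trans_symm c').symm)).trans
    ((CurveEquiv.assoc _ _ _).symm.trans
      ((((CurveEquiv.refl c.symm).comp h.symm).trans (CurveEquiv.symm_trans c)).comp
        (CurveEquiv.refl c'.symm) |>.trans (CurveEquiv.refl_trans _)))

/-- Equivalence of curves as a setoid. -/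
def curveSetoid (d : ℕ) {M : Type u} [TopologicalSpace M]
    [ChartedSpace (EuclideanSpace ℝ (Fin d)) M] (x y : M) : Setoid (Curve d x y) :=
  ⟨CurveEquiv, CurveEquiv.refl, CurveEquiv.symm, CurveEquiv.trans⟩

/-- The objects of the groupoid of paths `𝒫` of the manifold `M`: the points of `M`. -/
@[nolint unusedArguments]
def PathGroupoid (_d : ℕ) (M : Type u) : Type u := M

/-- The class in `𝒫` of a curve. -/
def Curve.toQuot {x y : M} (c : Curve d x y) : Quotient (curveSetoid d x y) :=
  Quotient.mk _ c

/-- The groupoid of paths `𝒫`: an arrow from `x` to `y` is an equivalence class of curves from `x`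
to `y`. In `p ≫ q` the path `p` comes first, so `p ≫ q` is the product written `q p`. -/
instance : Groupoid (PathGroupoid d M) where
  Hom x y := Quotient (curveSetoid d (M := M) x y)
  id x := (Curve.refl (M := M) x).toQuot
  comp := Quotient.map₂ Curve.trans fun _ _ h _ _ h' => CurveEquiv.comp h h'
  inv := Quotient.map Curve.symm fun _ _ h => CurveEquiv.symm_congr h
  id_comp := by rintro x y ⟨c⟩; exact Quotient.sound (CurveEquiv.refl_trans c)
  comp_id := by rintro x y ⟨c⟩; exact Quotient.sound (CurveEquiv.trans_refl c)
  assoc := by rintro w x y z ⟨a⟩ ⟨b⟩ ⟨c⟩; exact Quotient.sound (CurveEquiv.assoc a b c)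
  inv_comp := by rintro x y ⟨c⟩; exact Quotient.sound (CurveEquiv.symm_trans c)
  comp_inv := by rintro x y ⟨c⟩; exact Quotient.sound (CurveEquiv.trans_symm c)

/-- The path, i.e. arrow of `𝒫`, defined by a curve. -/
def Curve.toPath {x y : M} (c : Curve d x y) :
    (show PathGroupoid d M from x) ⟶ (show PathGroupoid d M from y) :=
  c.toQuot

end Groupoid

/-! ### Spaces of morphisms from a groupoid to a group -/

section Hom

variable (C : Type u) [Groupoid C] (G : Type v) [Group G]

/-- `Hom[C, G]`: the morphisms (functors) from the groupoid `C` to the group `G`. In the category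
`SingleObj G` the composite `g ≫ h` is `h * g`, so a functor `A` satisfies `A (q p) = A q * A p`,
where `q p` means first `p`, then `q`. -/
def GroupoidHom : Type _ := C ⥤ SingleObj G

variable {C G}

/-- The value `A(p) ∈ G` of a morphism at an arrow. -/
def GroupoidHom.eval (A : GroupoidHom C G) {x y : C} (p : x ⟶ y) : G :=
  CategoryTheory.Functor.map (C := C) (D := SingleObj G) A p

/-- The weakest topology for which all evaluations `A ↦ A(p)` at arrows `p` are continuous. If `C`
is generated by arrows `e₁, …, eₙ`, evaluations at arrows are words in the `A(eᵢ)^{±1}`, so this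
is the topology induced by the map `A ↦ (A(e₁), …, A(eₙ)) ∈ Gⁿ`. -/
instance [TopologicalSpace G] : TopologicalSpace (GroupoidHom C G) :=
  ⨅ (x : C) (y : C) (p : x ⟶ y), TopologicalSpace.induced (fun A => A.eval p) inferInstance

theorem GroupoidHom.continuous_eval [TopologicalSpace G] {x y : C} (p : x ⟶ y) :
    Continuous fun A : GroupoidHom C G => A.eval p :=
  continuous_iInf_dom (i := x) <| continuous_iInf_dom (i := y) <|
    continuous_iInf_dom (i := p) continuous_induced_dom

/-- The restriction of morphisms to a subgroupoid `L` of `C`, as a continuous map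
`p_L : Hom[C, G] → Hom[L, G]`. -/
def restrict [TopologicalSpace G] (L : Subgroupoid C) :
    C(GroupoidHom C G, GroupoidHom L.objs G) where
  toFun A := L.hom ⋙ (A : C ⥤ SingleObj G)
  continuous_toFun := by
    refine continuous_iInf_rng.2 fun x => continuous_iInf_rng.2 fun y =>
      continuous_iInf_rng.2 fun p => continuous_induced_rng.2 ?_
    exact (GroupoidHom.continuous_eval (G := G) (L.hom.map p) :)

/-- For a subgroupoid `L` of `C`, the value of a morphism `A : L → G` at an arrow of `C` that
belongs to `L`. -/
def GroupoidHom.evalMem {L : Subgroupoid C} (A : GroupoidHom L.objs G) {x y : C} (p : x ⟶ y)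
    (hp : p ∈ L.arrows x y) : G :=
  A.eval (x := (⟨x, L.mem_objs_of_src hp⟩ : L.objs)) (y := ⟨y, L.mem_objs_of_tgt hp⟩) ⟨p, hp⟩

variable (C) in
/-- An arrow of `C` together with its source and range. -/
structure ArrowOf where
  src : C
  tgt : C
  hom : src ⟶ tgt

/-- The subgroupoid generated by a family of arrows: the smallest subgroupoid that contains
them. -/
def generatedBy {ι : Type*} (e : ι → ArrowOf C) : Subgroupoid C :=
  Subgroupoid.generated fun x y => {p | ∃ i, e i = ⟨x, y, p⟩}

theorem mem_generatedBy {ι : Type*} (e : ι → ArrowOf C) (i : ι) :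
    (e i).hom ∈ (generatedBy e).arrows (e i).src (e i).tgt :=
  Subgroupoid.subset_generated _ _ _ ⟨i, rfl⟩

end Hom

/-! ### Edges, tame subgroupoids, generalized connections and cylindrical functions -/

section Cyl

variable {d : ℕ} {M : Type u} [TopologicalSpace M] [ChartedSpace (EuclideanSpace ℝ (Fin d)) M]

/-- A path `p` is an edge, represented by the curve `c`: `c` is analytic in its whole domain
(embedded on `]0,1[`, as are all pieces of curves), and `p` is the class of `c`. -/
def IsEdgeCurve (p : ArrowOf (PathGroupoid d M))
    (c : Curve d (show M from p.src) (show M from p.tgt)) : Prop :=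
  IsAnalyticArc d c.1.extend 0 1 ∧ c.toPath = p.hom

/-- A finite family of edges is independent if the edges can meet each other only at their
source or range. The image of an edge is the image `c([0,1])` of an analytic curve `c` that
represents it. -/
def IsIndependent {n : ℕ} (e : Fin n → ArrowOf (PathGroupoid d M)) : Prop :=
  ∃ c : ∀ i, Curve d (show M from (e i).src) (show M from (e i).tgt),
    (∀ i, IsEdgeCurve (e i) (c i)) ∧
    ∀ i j, i ≠ j → Set.range (c i).1 ∩ Set.range (c j).1 ⊆
      ({(show M from (e i).src), (show M from (e i).tgt)} : Set M)

variable (d M) in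
/-- The set `ℒ` of tame subgroupoids of `𝒫`: those generated by an independent (finite) set of
edges. -/
def TameSubgroupoid : Type u :=
  {L : Subgroupoid (PathGroupoid d M) //
    ∃ (n : ℕ) (e : Fin n → ArrowOf (PathGroupoid d M)), IsIndependent e ∧ L = generatedBy e}

variable (d M) in
/-- The space `Ā` of generalized connections: all morphisms from the groupoid of paths to `G`,
with the weakest topology such that all evaluations at paths are continuous. -/
abbrev GeneralizedConnections (G : Type v) [Group G] : Type _ :=
  GroupoidHom (PathGroupoid d M) G

/-- `𝒜_L = Hom[L, G]` for a tame subgroupoid `L`. -/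
abbrev ConnectionsOn (L : TameSubgroupoid d M) (G : Type v) [Group G] : Type _ :=
  GroupoidHom L.1.objs G

/-- For `L` generated by the arrows `e₁, …, eₙ`, the map
`ρ : 𝒜_L → Gⁿ`, `A ↦ (A(e₁), …, A(eₙ))`. -/
def rho {G : Type v} [Group G] (L : TameSubgroupoid d M) {n : ℕ}
    (e : Fin n → ArrowOf (PathGroupoid d M)) (hL : L.1 = generatedBy e)
    (A : ConnectionsOn L G) : Fin n → G :=
  fun i => A.evalMem (e i).hom (hL ▸ mem_generatedBy e i)

/-- The pull-back `p_L^* : C(𝒜_L) → C(Ā)`, a morphism of `*`-algebras. -/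
def pullback (G : Type v) [Group G] [TopologicalSpace G] (L : TameSubgroupoid d M) :
    C(ConnectionsOn L G, ℂ) →⋆ₐ[ℂ] C(GeneralizedConnections d M G, ℂ) :=
  ContinuousMap.compStarAlgHom' ℂ ℂ (restrict L.1)

variable (d M) in
/-- The cylindrical functions: `Cyl(Ā) = ⋃_L p_L^* C(𝒜_L)`. -/
def Cyl (G : Type v) [Group G] [TopologicalSpace G] : Set C(GeneralizedConnections d M G, ℂ) :=
  ⋃ L : TameSubgroupoid d M, Set.range (pullback G L)

/-- `f ∈ C^k(𝒜_L)`: under the identification `ρ` of `𝒜_L` with `Gⁿ` given by an independent set of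
generating edges, `f` is a `C^k` function on the manifold `Gⁿ`. -/
def IsCk {m : ℕ} {G : Type v} [Group G] [TopologicalSpace G]
    [ChartedSpace (EuclideanSpace ℝ (Fin m)) G] (k : ℕ∞) (L : TameSubgroupoid d M)
    (f : C(ConnectionsOn L G, ℂ)) : Prop :=
  ∃ (n : ℕ) (e : Fin n → ArrowOf (PathGroupoid d M)) (_ : IsIndependent e)
    (hL : L.1 = generatedBy e) (F : (Fin n → G) → ℂ),
    ContMDiff (ModelWithCorners.pi fun _ : Fin n => 𝓡 m) 𝓘(ℝ, ℂ) k F ∧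
    ∀ A, f A = F (rho L e hL A)

variable (d M) in
/-- `Cyl^k(Ā) = ⋃_L p_L^* C^k(𝒜_L)`. -/
def CylK (m : ℕ) (G : Type v) [Group G] [TopologicalSpace G]
    [ChartedSpace (EuclideanSpace ℝ (Fin m)) G] (k : ℕ∞) :
    Set C(GeneralizedConnections d M G, ℂ) :=
  ⋃ L : TameSubgroupoid d M, pullback G L '' {f | IsCk (m := m) k L f}

end Cyl

end GenConn

end

/-! The heart of the matter is that the set of tame subgroupoids is directed
(`TameSubgroupoid.exists_le`). Two cylindrical functions are then pulled back from one common `𝒜_L`,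
so sums, products and conjugates are again cylindrical. For `C^k` functions one also needs that the
values of a connection at the generators of a smaller subgroupoid are words in its values at the
generators of the larger one, hence smooth functions on `Gⁿ` (`exists_word`).

Directedness rests on analyticity. If two analytic half-germs meet arbitrarily close to a common
starting point, then one runs inside the image of the other (`exists_tendsto_of_frequently_eq`): in
a suitable common parameter, a root of a linear coordinate, both become analytic germs that coincide
at points accumulating at `0`, and the identity theorem applies. By compactness, an arc therefore
enters and leaves the image of another arc only finitely often (`finite_frontier`). Cutting finitely
many arcs at the finitely many points so obtained gives cells whose open images are pairwise equal
or disjoint (`IsNodeSet.image_eq_image`). Cells with the same image define the same path up to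
orientation (`Curve.toPath_mem_of_image_eq`), so one cell per image yields an independent set
generating all the given edges (`exists_isIndependent`).

Density is the Stone–Weierstrass theorem on the compact space `Ā`, a closed subspace of a power of
`G`. Points are separated because edges generate all paths: two distinct connections differ at some
edge, a single edge is an independent set, and smooth functions separate the points of `G`. -/

noncomputable section

namespace GenConn

universe u v

/-! ### Smooth maps into and out of the product manifold `Gⁿ`. -/

section PiManifold

variable {ι : Type*} [Fintype ι] {E : Type*} [NormedAddCommGroup E] [NormedSpace ℝ E]
  {H : Type*} [TopologicalSpace H] {I : ModelWithCorners ℝ E H}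
  {G : Type*} [TopologicalSpace G] [ChartedSpace H G]

/-- The product chart acts componentwise, so in charts the projection onto a factor is the linear
projection of `ι → E`. -/
theorem contMDiff_pi_apply (n : ℕ∞ω) (i : ι) :
    ContMDiff (ModelWithCorners.pi fun _ : ι => I) I n (fun x : ι → G => x i) := by
  intro x
  refine contMDiffAt_iff.2 ⟨(continuous_apply i).continuousAt, ?_⟩
  have hx := extChartAt_target_mem_nhdsWithin (I := ModelWithCorners.pi fun _ : ι => I) x
  refine ContDiffWithinAt.congr_of_eventuallyEq (f := fun y : ι → E => y i)
    (contDiff_apply ℝ E i).contDiffWithinAt ?_ ?_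
  · filter_upwards [hx] with y hy
    exact congrFun ((extChartAt (ModelWithCorners.pi fun _ : ι => I) x).right_inv hy) i
  · exact congrFun ((extChartAt (ModelWithCorners.pi fun _ : ι => I) x).right_inv
      (mem_extChartAt_target x)) i

theorem contMDiff_pi {E' : Type*} [NormedAddCommGroup E'] [NormedSpace ℝ E']
    {H' : Type*} [TopologicalSpace H'] {I' : ModelWithCorners ℝ E' H'}
    {N : Type*} [TopologicalSpace N] [ChartedSpace H' N] {n : ℕ∞ω} {f : N → ι → G}
    (hf : ∀ i, ContMDiff I' I n (fun x => f x i)) :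
    ContMDiff I' (ModelWithCorners.pi fun _ : ι => I) n f := by
  intro x
  refine contMDiffAt_iff.2 ⟨continuousAt_pi.2 fun i => (hf i x).continuousAt, ?_⟩
  refine contDiffWithinAt_pi.2 fun i => ?_
  exact (contMDiffAt_iff.1 (hf i x)).2

end PiManifold

/-! ### Morphisms from a groupoid to a group: compactness and words in generators. -/

section Algebra

variable {C : Type u} [Groupoid C] {G : Type v} [Group G]

theorem GroupoidHom.eval_comp (A : GroupoidHom C G) {x y z : C} (p : x ⟶ y) (q : y ⟶ z) :
    A.eval (p ≫ q) = A.eval q * A.eval p :=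
  CategoryTheory.Functor.map_comp (C := C) (D := SingleObj G) A p q

theorem GroupoidHom.eval_id (A : GroupoidHom C G) (x : C) : A.eval (𝟙 x) = 1 :=
  CategoryTheory.Functor.map_id (C := C) (D := SingleObj G) A x

theorem GroupoidHom.eval_inv (A : GroupoidHom C G) {x y : C} (p : x ⟶ y) :
    A.eval (Groupoid.inv p) = (A.eval p)⁻¹ := by
  rw [eq_inv_iff_mul_eq_one, ← eval_comp, Groupoid.comp_inv, eval_id]

theorem GroupoidHom.ext {A B : GroupoidHom C G}
    (h : ∀ (x y : C) (p : x ⟶ y), A.eval p = B.eval p) : A = B := by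
  refine CategoryTheory.Functor.ext (C := C) (D := SingleObj G) (F := A) (G := B)
    (fun x => rfl) fun x y p => ?_
  simp only [eqToHom_refl, Category.comp_id, Category.id_comp]
  exact h x y p

/-- A function on arrows that is compatible with composition is a morphism to the group. -/
def GroupoidHom.mk' (f : ∀ {x y : C}, (x ⟶ y) → G) (h1 : ∀ x : C, f (𝟙 x) = 1)
    (hc : ∀ {x y z : C} (p : x ⟶ y) (q : y ⟶ z), f (p ≫ q) = f q * f p) : GroupoidHom C G :=
  ({ obj := fun _ => SingleObj.star G
     map := fun p => f p
     map_id := h1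
     map_comp := fun p q => hc p q } : C ⥤ SingleObj G)

theorem GroupoidHom.evalMem_comp {L : Subgroupoid C} (A : GroupoidHom L.objs G) {x y z : C}
    {p : x ⟶ y} {q : y ⟶ z} (hp : p ∈ L.arrows x y) (hq : q ∈ L.arrows y z) :
    A.evalMem (p ≫ q) (L.mul hp hq) = A.evalMem q hq * A.evalMem p hp :=
  A.eval_comp (C := L.objs) (x := ⟨x, L.mem_objs_of_src hp⟩) (y := ⟨y, L.mem_objs_of_tgt hp⟩)
    (z := ⟨z, L.mem_objs_of_tgt hq⟩) ⟨p, hp⟩ ⟨q, hq⟩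

theorem GroupoidHom.evalMem_inv {L : Subgroupoid C} (A : GroupoidHom L.objs G) {x y : C}
    {p : x ⟶ y} (hp : p ∈ L.arrows x y) :
    A.evalMem (Groupoid.inv p) (L.inv hp) = (A.evalMem p hp)⁻¹ :=
  A.eval_inv (C := L.objs) (x := ⟨x, L.mem_objs_of_src hp⟩) (y := ⟨y, L.mem_objs_of_tgt hp⟩)
    ⟨p, hp⟩

theorem generatedBy_le {ι : Type*} {e : ι → ArrowOf C} {L : Subgroupoid C}
    (h : ∀ i, (e i).hom ∈ L.arrows (e i).src (e i).tgt) : generatedBy e ≤ L := by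
  refine sInf_le ?_
  rintro x y p ⟨i, hi⟩
  have := h i
  rw [hi] at this
  exact this

variable [TopologicalSpace G]

/-- Puts the topology in the form to which Tychonoff's theorem applies, as induced from the product
of copies of `G` indexed by all arrows. -/
theorem GroupoidHom.isInducing_eval :
    Topology.IsInducing fun (A : GroupoidHom C G) (a : ArrowOf C) => A.eval a.hom := by
  constructor
  rw [Pi.topologicalSpace, induced_iInf]
  refine le_antisymm ?_ ?_
  · refine le_iInf fun a => ?_
    rw [induced_compose]
    exact (GroupoidHom.continuous_eval a.hom).le_induced
  · refine le_iInf fun x => le_iInf fun y => le_iInf fun p => ?_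
    refine (iInf_le _ ⟨x, y, p⟩).trans ?_
    rw [induced_compose]
    rfl

/-- The functor identities are closed conditions on families in the compact product of copies of
`G`, and the families satisfying them are exactly the morphisms. -/
theorem GroupoidHom.compactSpace [IsTopologicalGroup G] [CompactSpace G] [T2Space G] :
    CompactSpace (GroupoidHom C G) := by
  refine (Topology.IsClosedEmbedding.mk ⟨GroupoidHom.isInducing_eval, ?_⟩ ?_).compactSpace
    (f := fun (A : GroupoidHom C G) (a : ArrowOf C) => A.eval a.hom)
  · intro A B h
    exact GroupoidHom.ext fun x y p => congrFun h ⟨x, y, p⟩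
  · have : Set.range (fun (A : GroupoidHom C G) (a : ArrowOf C) => A.eval a.hom) =
        (⋂ x : C, {f : ArrowOf C → G | f ⟨x, x, 𝟙 x⟩ = 1}) ∩
        ⋂ (x : C) (y : C) (z : C) (p : x ⟶ y) (q : y ⟶ z),
          {f : ArrowOf C → G | f ⟨x, z, p ≫ q⟩ = f ⟨y, z, q⟩ * f ⟨x, y, p⟩} := by
      ext f
      simp only [Set.mem_range, Set.mem_inter_iff, Set.mem_iInter, Set.mem_ofPred_eq]
      constructor
      · rintro ⟨A, rfl⟩
        exact ⟨fun x => A.eval_id x, fun x y z p q => A.eval_comp p q⟩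
      · rintro ⟨h1, hc⟩
        exact ⟨GroupoidHom.mk' (fun {x y} p => f ⟨x, y, p⟩) h1 fun p q => hc _ _ _ p q, rfl⟩
    rw [this]
    refine IsClosed.inter (isClosed_iInter fun x => ?_) (isClosed_iInter fun x =>
      isClosed_iInter fun y => isClosed_iInter fun z => isClosed_iInter fun p =>
      isClosed_iInter fun q => ?_)
    · exact isClosed_eq (continuous_apply _) continuous_const
    · exact isClosed_eq (continuous_apply _) (by fun_prop)

theorem GroupoidHom.continuous_evalMem {L : Subgroupoid C} {x y : C} (p : x ⟶ y)
    (hp : p ∈ L.arrows x y) : Continuous fun A : GroupoidHom L.objs G => A.evalMem p hp :=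
  GroupoidHom.continuous_eval (C := L.objs) _

/-- The restriction of morphisms from a subgroupoid to a smaller one. -/
def restrictOfLE {L L' : Subgroupoid C} (h : L ≤ L') :
    C(GroupoidHom L'.objs G, GroupoidHom L.objs G) where
  toFun A := Subgroupoid.inclusion h ⋙ (A : L'.objs ⥤ SingleObj G)
  continuous_toFun := by
    refine continuous_iInf_rng.2 fun x => continuous_iInf_rng.2 fun y =>
      continuous_iInf_rng.2 fun p => continuous_induced_rng.2 ?_
    exact (GroupoidHom.continuous_eval (G := G) ((Subgroupoid.inclusion h).map p) :)

/-- The arrows whose evaluations are smooth functions of the evaluations at the generators. -/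
def smoothlyDetermined {m : ℕ} [ChartedSpace (EuclideanSpace ℝ (Fin m)) G] [LieGroup (𝓡 m) ∞ G]
    (L : Subgroupoid C) {n : ℕ} (r : GroupoidHom L.objs G → Fin n → G) : Subgroupoid C where
  arrows x y := {p | ∃ (hp : p ∈ L.arrows x y) (W : (Fin n → G) → G),
    ContMDiff (ModelWithCorners.pi fun _ : Fin n => 𝓡 m) (𝓡 m) ∞ W ∧
      ∀ A, A.evalMem p hp = W (r A)}
  inv := by
    rintro x y p ⟨hp, W, hW, h⟩
    exact ⟨L.inv hp, fun g => (W g)⁻¹, hW.inv, fun A => by rw [A.evalMem_inv hp, h]⟩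
  mul := by
    rintro x y z p ⟨hp, W, hW, h⟩ q ⟨hq, W', hW', h'⟩
    exact ⟨L.mul hp hq, fun g => W' g * W g, hW'.mul hW,
      fun A => by rw [A.evalMem_comp hp hq, h, h']⟩

/-- Multiplication and inversion of `G` are smooth, so the arrows with this property form a
subgroupoid, and it suffices to look at the generators, where `W` is a coordinate projection. -/
theorem exists_word {m : ℕ} [ChartedSpace (EuclideanSpace ℝ (Fin m)) G] [LieGroup (𝓡 m) ∞ G]
    {L : Subgroupoid C} {n : ℕ} (e : Fin n → ArrowOf C) (hL : L = generatedBy e)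
    {x y : C} {p : x ⟶ y} (hp : p ∈ L.arrows x y) :
    ∃ W : (Fin n → G) → G,
      ContMDiff (ModelWithCorners.pi fun _ : Fin n => 𝓡 m) (𝓡 m) ∞ W ∧
      ∀ A : GroupoidHom L.objs G, A.evalMem p hp =
        W fun i => A.evalMem (e i).hom (hL ▸ mem_generatedBy e i) := by
  have hle : L ≤ smoothlyDetermined (G := G) (m := m) L
      (fun A (i : Fin n) => A.evalMem (e i).hom (hL ▸ mem_generatedBy e i)) := by
    conv_lhs => rw [hL]
    exact generatedBy_le fun i =>
      ⟨hL ▸ mem_generatedBy e i, fun g => g i, contMDiff_pi_apply _ i, fun A => rfl⟩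
  exact ((Subgroupoid.le_iff _ _).1 hle hp).2

end Algebra

/-! ### Analytic half-germs in a normed space that meet infinitely often. -/

section Germs

open Filter Topology

theorem tendsto_nhdsGT_of_hasDerivAt_pos {f : ℝ → ℝ} {c : ℝ} (h : HasDerivAt f c 0)
    (h0 : f 0 = 0) (hc : 0 < c) : Tendsto f (𝓝[>] 0) (𝓝[>] 0) := by
  refine tendsto_nhdsWithin_iff.2 ⟨?_, ?_⟩
  · have := h.continuousAt.tendsto
    rw [h0] at this
    exact this.mono_left nhdsWithin_le_nhds
  · have h1 := (hasDerivAt_iff_tendsto_slope.1 h).eventually (lt_mem_nhds hc)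
    have h2 : ∀ᶠ s in 𝓝[>] (0 : ℝ), 0 < slope f 0 s :=
      h1.filter_mono (nhdsWithin_mono _ fun x (hx : 0 < x) => ne_of_gt hx)
    filter_upwards [h2, self_mem_nhdsWithin] with s hs (hs0 : 0 < s)
    rw [slope_def_field, h0, sub_zero, sub_zero] at hs
    exact (div_pos_iff_of_pos_right hs0).1 hs

/-- An analytic function `r` with a zero of order `p` and positive leading coefficient is, to the
right of the zero, the `p`-th power of an analytic local coordinate `σ` with inverse `S`. -/
theorem exists_root_coordinate {r u : ℝ → ℝ} {p : ℕ} (hp : p ≠ 0) (hu : AnalyticAt ℝ u 0)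
    (hu0 : 0 < u 0) (hr : ∀ᶠ s in 𝓝 (0 : ℝ), r s = s ^ p * u s) :
    ∃ σ S : ℝ → ℝ, AnalyticAt ℝ S 0 ∧ S 0 = 0 ∧ Tendsto S (𝓝[>] 0) (𝓝[>] 0) ∧
      Tendsto σ (𝓝[>] 0) (𝓝[>] 0) ∧ (∀ᶠ s in 𝓝[>] 0, S (σ s) = s) ∧
      ∀ᶠ s in 𝓝[>] 0, σ s ^ p = r s := by
  -- Near `0` this is the `p`-th root of `u`, so `σ s = s * ρ s` satisfies `σ s ^ p = s ^ p * u s`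
  -- and has the nonzero derivative `ρ 0` at `0`.
  set ρ : ℝ → ℝ := fun s => Real.exp (Real.log (u s) / p) with hρ
  have hρa : AnalyticAt ℝ ρ 0 := ((hu.log hu0).div_const).rexp
  set σ : ℝ → ℝ := fun s => s * ρ s with hσ
  have hσa : AnalyticAt ℝ σ 0 := analyticAt_id.mul hρa
  have hσ0 : σ 0 = 0 := by simp [hσ]
  have hd : HasDerivAt σ (ρ 0) 0 := by
    have := (hasDerivAt_id (0 : ℝ)).mul hρa.differentiableAt.hasDerivAt
    exact this.congr_deriv (by simp)
  have hpos : 0 < ρ 0 := Real.exp_pos _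
  have hd' : deriv σ 0 ≠ 0 := by rw [hd.deriv]; exact hpos.ne'
  have hSa := hσa.analyticAt_localInverse hd'
  have hinv := hσa.hasStrictDerivAt.eventually_left_inverse hd'
  have hSd := hσa.hasStrictDerivAt.to_localInverse hd'
  set S := hσa.hasStrictDerivAt.localInverse _ _ _ hd' with hS
  rw [hσ0] at hSa hSd
  have hS0 : S 0 = 0 := by
    have := hinv.self_of_nhds
    rwa [hσ0] at this
  refine ⟨σ, S, hSa, hS0, tendsto_nhdsGT_of_hasDerivAt_pos hSd.hasDerivAt hS0 ?_,
    tendsto_nhdsGT_of_hasDerivAt_pos hd hσ0 hpos, hinv.filter_mono nhdsWithin_le_nhds, ?_⟩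
  · rw [hd.deriv]; exact inv_pos.2 hpos
  · have h1 : ∀ᶠ s in 𝓝 (0 : ℝ), 0 < u s := hu.continuousAt.eventually (lt_mem_nhds hu0)
    refine Eventually.filter_mono nhdsWithin_le_nhds ?_
    filter_upwards [hr, h1] with s hs hus
    rw [hs, hσ]
    simp only [mul_pow, hρ]
    rw [← Real.exp_nat_mul, mul_div_cancel₀ _ (Nat.cast_ne_zero.2 hp), Real.exp_log hus]

variable {E : Type*} [NormedAddCommGroup E] [NormedSpace ℝ E]

theorem exists_dual_ne_zero_ne_zero {v w : E} (hv : v ≠ 0) (hw : w ≠ 0) :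
    ∃ l : E →L[ℝ] ℝ, l v ≠ 0 ∧ l w ≠ 0 := by
  obtain ⟨f, hf⟩ := SeparatingDual.exists_ne_zero (R := ℝ) hv
  obtain ⟨g, hg⟩ := SeparatingDual.exists_ne_zero (R := ℝ) hw
  by_cases h1 : f w = 0
  · by_cases h2 : g v = 0
    · exact ⟨f + g, by simpa [h2], by simpa [h1]⟩
    · exact ⟨g, h2, hg⟩
  · exact ⟨f, hf, h1⟩

/-- The order of vanishing `p` is finite because the germ is not constant, and positive because `a s
- a 0` vanishes at `0`. -/
theorem exists_order {a : ℝ → E} (ha : AnalyticAt ℝ a 0)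
    (hna : ¬ ∀ᶠ s in 𝓝 (0 : ℝ), a s = a 0) :
    ∃ (p : ℕ) (a' : ℝ → E), p ≠ 0 ∧ AnalyticAt ℝ a' 0 ∧ a' 0 ≠ 0 ∧
      ∀ᶠ s in 𝓝 (0 : ℝ), a s - a 0 = s ^ p • a' s := by
  have hsub : AnalyticAt ℝ (fun s => a s - a 0) 0 := ha.sub analyticAt_const
  obtain ⟨p, a', h1, h2, h3⟩ := hsub.exists_eventuallyEq_pow_smul_nonzero_iff.2
    (by simpa only [sub_eq_zero] using hna)
  refine ⟨p, a', ?_, h1, h2, by simpa only [sub_zero] using h3⟩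
  rintro rfl
  have := h3.self_of_nhds
  simp only [sub_self, pow_zero, one_smul] at this
  exact h2 this.symm

/-- Two nonconstant analytic half-germs at the same point which meet at points arbitrarily close
to it have the same image. -/
theorem exists_tendsto_of_frequently_eq {a b : ℝ → E} (ha : AnalyticAt ℝ a 0)
    (hb : AnalyticAt ℝ b 0) (hab : a 0 = b 0) (hna : ¬ ∀ᶠ s in 𝓝 (0 : ℝ), a s = a 0)
    (hnb : ¬ ∀ᶠ s in 𝓝 (0 : ℝ), b s = b 0)
    (h : ∃ᶠ x : ℝ × ℝ in 𝓝[>] 0 ×ˢ 𝓝[>] 0, a x.1 = b x.2) :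
    ∃ ψ : ℝ → ℝ, Tendsto ψ (𝓝[>] 0) (𝓝[>] 0) ∧ ∀ᶠ s in 𝓝[>] 0, a s = b (ψ s) := by
  obtain ⟨p, a', hp, ha', ha0, hae⟩ := exists_order ha hna
  obtain ⟨q, b', hq, hb', hb0, hbe⟩ := exists_order hb hnb
  -- A functional that is nonzero on both leading coefficients gives a scalar coordinate along both
  -- curves; replacing it by its negative fixes the sign along `a`.
  obtain ⟨l, hla, hlb⟩ : ∃ l : E →L[ℝ] ℝ, 0 < l (a' 0) ∧ l (b' 0) ≠ 0 := by
    obtain ⟨l, h1, h2⟩ := exists_dual_ne_zero_ne_zero ha0 hb0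
    rcases h1.lt_or_gt with h1 | h1
    · exact ⟨-l, by simpa using h1, by simpa using h2⟩
    · exact ⟨l, h1, h2⟩
  have hua : AnalyticAt ℝ (fun s => l (a' s)) 0 := l.analyticAt _ |>.comp ha'
  have hub : AnalyticAt ℝ (fun s => l (b' s)) 0 := l.analyticAt _ |>.comp hb'
  have hra : ∀ᶠ s in 𝓝 (0 : ℝ), l (a s - a 0) = s ^ p * l (a' s) := by
    filter_upwards [hae] with s hs
    rw [hs, map_smul, smul_eq_mul]
  have hrb : ∀ᶠ s in 𝓝 (0 : ℝ), l (b s - b 0) = s ^ q * l (b' s) := by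
    filter_upwards [hbe] with s hs
    rw [hs, map_smul, smul_eq_mul]
  -- With the opposite sign, `l` would be positive along `a` and negative along `b`, measured from
  -- the common point, and the half-germs could not meet.
  have hlb' : 0 < l (b' 0) := by
    by_contra hneg
    have hneg : l (b' 0) < 0 := lt_of_le_of_ne (not_lt.1 hneg) hlb
    have e1 : ∀ᶠ s in 𝓝[>] (0 : ℝ), 0 < l (a s - a 0) := by
      filter_upwards [hra.filter_mono nhdsWithin_le_nhds, (hua.continuousAt.eventually
        (lt_mem_nhds hla)).filter_mono nhdsWithin_le_nhds, self_mem_nhdsWithin]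
        with s hs h1 (h2 : 0 < s)
      rw [hs]; positivity
    have e2 : ∀ᶠ s in 𝓝[>] (0 : ℝ), l (b s - b 0) < 0 := by
      filter_upwards [hrb.filter_mono nhdsWithin_le_nhds, (hub.continuousAt.eventually
        (gt_mem_nhds hneg)).filter_mono nhdsWithin_le_nhds, self_mem_nhdsWithin]
        with s hs h1 (h2 : 0 < s)
      rw [hs]; exact mul_neg_of_pos_of_neg (by positivity) h1
    obtain ⟨x, hx, h1, h2⟩ := (h.and_eventually (e1.prod_mk e2)).exists
    rw [hx, hab] at h1
    exact lt_asymm h1 h2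
  obtain ⟨σ, S, hSa, hS0, hS, hσ, hSσ, hσp⟩ := exists_root_coordinate hp hua hla hra
  obtain ⟨τ, T, hTa, hT0, hT, hτ, hTτ, hτq⟩ := exists_root_coordinate hq hub hlb' hrb
  have hpow : ∀ n : ℕ, n ≠ 0 → Tendsto (fun w : ℝ => w ^ n) (𝓝[>] 0) (𝓝[>] 0) := by
    intro n hn
    refine tendsto_nhdsWithin_iff.2 ⟨?_, ?_⟩
    · have : Tendsto (fun w : ℝ => w ^ n) (𝓝 0) (𝓝 (0 ^ n)) := (continuous_pow n).tendsto 0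
      rw [zero_pow hn] at this
      exact this.mono_left nhdsWithin_le_nhds
    · filter_upwards [self_mem_nhdsWithin] with w (hw : 0 < w)
      exact pow_pos hw n
  have hroot : Tendsto (fun w : ℝ => w ^ (1 / q : ℝ)) (𝓝[>] 0) (𝓝[>] 0) := by
    refine tendsto_nhdsWithin_iff.2 ⟨?_, ?_⟩
    · have : Tendsto (fun w : ℝ => w ^ (1 / q : ℝ)) (𝓝 0) (𝓝 (0 ^ (1 / q : ℝ))) :=
        (Real.continuous_rpow_const (by positivity)).tendsto 0
      rw [Real.zero_rpow (by positivity)] at this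
      exact this.mono_left nhdsWithin_le_nhds
    · filter_upwards [self_mem_nhdsWithin] with w (hw : 0 < w)
      exact Real.rpow_pos_of_pos hw _
  have hrq : ∀ x : ℝ, 0 < x → (x ^ (1 / q : ℝ)) ^ q = x := by
    intro x hx
    rw [one_div]
    exact Real.rpow_inv_natCast_pow hx.le hq
  -- At a meeting pair `(s, t)` one has `σ s ^ p = τ t ^ q`, so `w = σ s ^ (1 / q)` satisfies `w ^ q
  -- = σ s` and `w ^ p = τ t`. In this common parameter `w` both curves are analytic on both sides
  -- of `0`, and meeting pairs become coincidences at the same `w`.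
  have hfa : AnalyticAt ℝ (fun w : ℝ => a (S (w ^ q))) 0 := by
    refine AnalyticAt.fun_comp (g := a) (f := fun w => S (w ^ q)) (by simpa [hq, hS0] using ha) ?_
    exact AnalyticAt.fun_comp (g := S) (by simpa [hq] using hSa) (analyticAt_id.pow q)
  have hgb : AnalyticAt ℝ (fun w : ℝ => b (T (w ^ p))) 0 := by
    refine AnalyticAt.fun_comp (g := b) (f := fun w => T (w ^ p)) (by simpa [hp, hT0] using hb) ?_
    exact AnalyticAt.fun_comp (g := T) (by simpa [hp] using hTa) (analyticAt_id.pow p)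
  have hfreq : ∃ᶠ w in 𝓝[≠] (0 : ℝ), a (S (w ^ q)) = b (T (w ^ p)) := by
    have hev := (((hSσ.and hσp).and (hσ.eventually self_mem_nhdsWithin)).prod_mk
      ((hTτ.and hτq).and (hτ.eventually self_mem_nhdsWithin)))
    have htend : Tendsto (fun x : ℝ × ℝ => σ x.1 ^ (1 / q : ℝ)) (𝓝[>] 0 ×ˢ 𝓝[>] 0) (𝓝[≠] 0) :=
      ((hroot.comp hσ).comp tendsto_fst).mono_right
        (nhdsWithin_mono _ fun x (hx : 0 < x) => ne_of_gt hx)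
    refine htend.frequently ((h.and_eventually hev).mono ?_)
    rintro ⟨s, t⟩ ⟨hx, ⟨⟨h1, h2⟩, h3⟩, ⟨h4, h5⟩, h6⟩
    simp only at hx h1 h2 h4 h5 ⊢
    have h3 : 0 < σ s := h3
    have h6 : 0 < τ t := h6
    have key : (σ s ^ (1 / q : ℝ)) ^ p = τ t := by
      refine (pow_left_inj₀ (by positivity) h6.le hq).1 ?_
      rw [h5, ← hx, ← hab, ← h2, ← pow_mul, mul_comm, pow_mul, hrq _ h3]
    rw [hrq _ h3, key, h1, h4, hx]
  have hev := (hfa.frequently_eq_iff_eventually_eq hgb).1 hfreq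
  refine ⟨fun s => T ((σ s ^ (1 / q : ℝ)) ^ p), hT.comp ((hpow p hp).comp (hroot.comp hσ)), ?_⟩
  filter_upwards [(hroot.comp hσ).eventually (hev.filter_mono nhdsWithin_le_nhds), hSσ,
    hσ.eventually self_mem_nhdsWithin] with s h1 h2 (h3 : 0 < σ s)
  simp only [Function.comp] at h1
  rw [hrq _ h3, h2] at h1
  exact h1

end Germs

/-! ### Intersections of analytic arcs in the manifold. -/

section Arcs

open Filter Topology Set

variable {d : ℕ} {M : Type u} [TopologicalSpace M] [ChartedSpace (EuclideanSpace ℝ (Fin d)) M]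

theorem exists_analyticAt_chart {γ : ℝ → M}
    (h : ContMDiffWithinAt 𝓘(ℝ, ℝ) (𝓡 d) ω γ (Ici 0) 0) :
    ∃ g : ℝ → EuclideanSpace ℝ (Fin d), AnalyticAt ℝ g 0 ∧
      ∀ᶠ s in 𝓝[≥] (0 : ℝ), γ s ∈ (extChartAt (𝓡 d) (γ 0)).source ∧
        extChartAt (𝓡 d) (γ 0) (γ s) = g s := by
  have h1 := (contMDiffWithinAt_iff.1 h).2
  simp only [mfld_simps] at h1
  have h2 := contDiffWithinAt_omega_iff_analyticWithinAt.1 h1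
  obtain ⟨g, hg, hga⟩ := analyticWithinAt_iff_exists_analyticAt.1 h2
  rw [insert_eq_of_mem (by simp)] at hg
  refine ⟨g, hga, ?_⟩
  filter_upwards [hg, h.continuousWithinAt.eventually
    (extChartAt_source_mem_nhds (I := 𝓡 d) (γ 0))] with s hs hs'
  exact ⟨hs', hs⟩

/-- Two analytic injective half-germs of curves at the same point which meet at points arbitrarily
close to it have the same image. -/
theorem exists_tendsto_of_frequently_eq_manifold {γ δ : ℝ → M}
    (hγ : ContMDiffWithinAt 𝓘(ℝ, ℝ) (𝓡 d) ω γ (Ici 0) 0)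
    (hδ : ContMDiffWithinAt 𝓘(ℝ, ℝ) (𝓡 d) ω δ (Ici 0) 0) (h0 : γ 0 = δ 0)
    (hγn : ∀ᶠ s in 𝓝[>] (0 : ℝ), γ s ≠ γ 0) (hδn : ∀ᶠ s in 𝓝[>] (0 : ℝ), δ s ≠ δ 0)
    (h : ∃ᶠ x : ℝ × ℝ in 𝓝[>] 0 ×ˢ 𝓝[>] 0, γ x.1 = δ x.2) :
    ∃ ψ : ℝ → ℝ, Tendsto ψ (𝓝[>] 0) (𝓝[>] 0) ∧ ∀ᶠ s in 𝓝[>] 0, γ s = δ (ψ s) := by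
  obtain ⟨a, ha, hae⟩ := exists_analyticAt_chart hγ
  obtain ⟨b, hb, hbe⟩ := exists_analyticAt_chart hδ
  have ha0 := hae.self_of_nhdsWithin (mem_Ici.2 le_rfl)
  have hb0 := hbe.self_of_nhdsWithin (mem_Ici.2 le_rfl)
  have hle : 𝓝[>] (0 : ℝ) ≤ 𝓝[≥] 0 := nhdsWithin_mono _ Ioi_subset_Ici_self
  replace hae := hae.filter_mono hle
  replace hbe := hbe.filter_mono hle
  have hna : ¬ ∀ᶠ s in 𝓝 (0 : ℝ), a s = a 0 := by
    intro hc
    obtain ⟨s, ⟨h1, h2⟩, h3, h4⟩ :=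
      (hae.and (hγn.and (hc.filter_mono nhdsWithin_le_nhds))).exists
    refine h3 ((extChartAt (𝓡 d) (γ 0)).injOn h1 ha0.1 ?_)
    rw [h2, h4, ha0.2]
  have hnb : ¬ ∀ᶠ s in 𝓝 (0 : ℝ), b s = b 0 := by
    intro hc
    obtain ⟨s, ⟨h1, h2⟩, h3, h4⟩ :=
      (hbe.and (hδn.and (hc.filter_mono nhdsWithin_le_nhds))).exists
    refine h3 ((extChartAt (𝓡 d) (δ 0)).injOn h1 hb0.1 ?_)
    rw [h2, h4, hb0.2]
  rw [← h0] at hbe hb0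
  have hab : a 0 = b 0 := by rw [← ha0.2, ← hb0.2]
  obtain ⟨ψ, hψ, hψe⟩ := exists_tendsto_of_frequently_eq ha hb hab hna hnb
    ((h.and_eventually (hae.prod_mk hbe)).mono (by
      rintro ⟨s, t⟩ ⟨h1, h2, h3⟩
      simp only at h1 h2 h3 ⊢
      rw [← h2.2, ← h3.2, h1]))
  refine ⟨ψ, hψ, ?_⟩
  filter_upwards [hψe, hae, hψ.eventually hbe] with s h1 h2 h3
  refine (extChartAt (𝓡 d) (γ 0)).injOn h2.1 h3.1 ?_
  rw [h2.2, h1, h3.2]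

theorem IsAnalyticArc.restrict {α : ℝ → M} {a b a' b' : ℝ} (h : IsAnalyticArc d α a b)
    (ha : a ≤ a') (hb : b' ≤ b) : IsAnalyticArc d α a' b' := by
  refine h.comp_affine 1 0 one_ne_zero a' b' ?_ ?_ fun t _ => by simp
  · intro t ht; simpa using ⟨ha.trans ht.1, ht.2.trans hb⟩
  · intro t ht; simpa using ⟨ha.trans_lt ht.1, ht.2.trans_le hb⟩

theorem IsAnalyticArc.reverse {α : ℝ → M} (h : IsAnalyticArc d α 0 1) :
    IsAnalyticArc d (fun t => α (1 - t)) 0 1 := by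
  refine h.comp_affine (-1) 1 (by norm_num) 0 1 ?_ ?_ fun t _ => by
    congr 1; ring
  · intro t ht; constructor <;> linarith [ht.1, ht.2]
  · intro t ht; constructor <;> linarith [ht.1, ht.2]

theorem IsAnalyticArc.injOn {α : ℝ → M} {a b : ℝ} (h : IsAnalyticArc d α a b) :
    InjOn α (Ioo a b) := by
  intro s hs t ht hst
  have := h.embedding.injective (a₁ := ⟨s, hs⟩) (a₂ := ⟨t, ht⟩) hst
  exact congrArg Subtype.val this

/-- The embedding property also excludes that an endpoint returns to an interior point: if `α t = α
s`, interior parameters tending to `t` have images tending to `α s`, so they tend to `s` and `t =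
s`. The two endpoints may still have the same image. -/
theorem IsAnalyticArc.ne_of_mem_Ioo {α : ℝ → M} {a b s t : ℝ} (h : IsAnalyticArc d α a b)
    (hs : s ∈ Ioo a b) (ht : t ∈ Icc a b) (hst : s ≠ t) : α s ≠ α t := by
  intro heq
  have hab : a < b := hs.1.trans hs.2
  have hc : Tendsto α (𝓝[Ioo a b] t) (𝓝 (α s)) := by
    rw [heq]
    exact (h.analytic.continuousOn t ht).mono Ioo_subset_Icc_self
  have hne : (𝓝[Ioo a b] t).NeBot := by
    rw [← mem_closure_iff_nhdsWithin_neBot, closure_Ioo hab.ne]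
    exact ht
  have h1 : Tendsto (fun x : Ioo a b => α x) (comap Subtype.val (𝓝 t)) (𝓝 (α s)) := by
    rw [nhdsWithin, ← map_comap_setCoe_val] at hc
    exact hc
  have h2 : comap (Subtype.val : Ioo a b → ℝ) (𝓝 t) ≤ 𝓝 ⟨s, hs⟩ := by
    rw [h.embedding.isInducing.nhds_eq_comap]
    exact tendsto_iff_comap.1 h1
  have h3 : 𝓝[Ioo a b] t ≤ 𝓝 s := by
    rw [nhdsWithin, ← map_comap_setCoe_val]
    exact (map_mono h2).trans continuous_subtype_val.continuousAt
  exact hst (tendsto_nhds_unique (f := id) (l := 𝓝[Ioo a b] t) h3 nhdsWithin_le_nhds)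


/-- The half-germ of an arc to the right of a point. -/
theorem IsAnalyticArc.contMDiffWithinAt_right {α : ℝ → M} (h : IsAnalyticArc d α 0 1) {s : ℝ}
    (hs : s ∈ Ico (0 : ℝ) 1) :
    ContMDiffWithinAt 𝓘(ℝ, ℝ) (𝓡 d) ω (fun t => α (s + t)) (Ici 0) 0 := by
  have h1 : ContMDiffWithinAt 𝓘(ℝ, ℝ) (𝓡 d) ω α (Icc 0 1) (s + 0) := by
    rw [add_zero]; exact h.analytic s ⟨hs.1, hs.2.le⟩
  have hA : ContMDiff 𝓘(ℝ, ℝ) 𝓘(ℝ, ℝ) ω (fun t : ℝ => s + t) := by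
    rw [contMDiff_iff_contDiff]; fun_prop
  have h2 := h1.comp (s := Icc 0 (1 - s)) (f := fun t => s + t) (0 : ℝ) (hA 0).contMDiffWithinAt
    (fun t ht => ⟨by linarith [ht.1, hs.1], by linarith [ht.2]⟩)
  exact h2.mono_of_mem_nhdsWithin (Icc_mem_nhdsGE (by linarith [hs.2]))

theorem map_add_nhdsGT (s : ℝ) : map (fun t => s + t) (𝓝[>] (0 : ℝ)) = 𝓝[>] s := by
  simp

theorem eventually_ne_right {α : ℝ → M} (h : IsAnalyticArc d α 0 1) {s : ℝ}
    (hs : s ∈ Ico (0 : ℝ) 1) : ∀ᶠ t in 𝓝[>] (0 : ℝ), α (s + t) ≠ α (s + 0) := by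
  rw [add_zero]
  have : Ioo 0 (1 - s) ∈ 𝓝[>] (0 : ℝ) := Ioo_mem_nhdsGT (by linarith [hs.2])
  filter_upwards [this] with t ht
  exact h.ne_of_mem_Ioo ⟨by linarith [hs.1, ht.1], by linarith [ht.2]⟩ ⟨hs.1, hs.2.le⟩
    (by linarith [ht.1])

/-- Overlap of the right half-germs of two arcs. -/
theorem eventually_mem_image_of_frequently {α β : ℝ → M} (hα : IsAnalyticArc d α 0 1)
    (hβ : IsAnalyticArc d β 0 1) {s t : ℝ} (hs : s ∈ Ico (0 : ℝ) 1) (ht : t ∈ Ico (0 : ℝ) 1)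
    (h0 : α s = β t) (h : ∃ᶠ x : ℝ × ℝ in 𝓝[>] s ×ˢ 𝓝[>] t, α x.1 = β x.2) :
    ∀ᶠ x in 𝓝[>] s, α x ∈ β '' Icc 0 1 := by
  rw [← map_add_nhdsGT s, ← map_add_nhdsGT t, prod_map_map_eq, frequently_map] at h
  obtain ⟨ψ, hψ, hψe⟩ := exists_tendsto_of_frequently_eq_manifold
    (hα.contMDiffWithinAt_right hs) (hβ.contMDiffWithinAt_right ht) (by simpa using h0)
    (eventually_ne_right hα hs) (eventually_ne_right hβ ht) h
  rw [← map_add_nhdsGT s, eventually_map]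
  have : Ioo 0 (1 - t) ∈ 𝓝[>] (0 : ℝ) := Ioo_mem_nhdsGT (by linarith [ht.2])
  filter_upwards [hψe, hψ.eventually this] with x h1 h2
  exact ⟨t + ψ x, ⟨by linarith [ht.1, h2.1], by linarith [h2.2]⟩, h1.symm⟩

theorem image_reverse {X : Type*} (β : ℝ → X) :
    (fun t => β (1 - t)) '' Icc 0 1 = β '' Icc 0 1 := by
  ext z
  constructor
  · rintro ⟨t, ht, rfl⟩
    exact ⟨1 - t, ⟨by linarith [ht.2], by linarith [ht.1]⟩, rfl⟩
  · rintro ⟨t, ht, rfl⟩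
    exact ⟨1 - t, ⟨by linarith [ht.2], by linarith [ht.1]⟩, by simp⟩

theorem map_one_sub_nhdsLT (t : ℝ) : map (fun x => 1 - x) (𝓝[<] t) = 𝓝[>] (1 - t) := by
  simp

/-- To the right of each point, an arc is either inside or outside the image of another arc. -/
theorem tame_right [T2Space M] {α β : ℝ → M} (hα : IsAnalyticArc d α 0 1)
    (hβ : IsAnalyticArc d β 0 1) {s : ℝ} (hs : s ∈ Ico (0 : ℝ) 1) :
    (∀ᶠ x in 𝓝[>] s, α x ∈ β '' Icc 0 1) ∨ ∀ᶠ x in 𝓝[>] s, α x ∉ β '' Icc 0 1 := by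
  refine or_iff_not_imp_right.2 fun hn => ?_
  have hfreq : ∃ᶠ x in 𝓝[>] s, α x ∈ β '' Icc 0 1 := by
    simpa only [Filter.Frequently] using hn
  -- `F` describes the meeting pairs of parameters whose first component decreases to `s`.
  -- Compactness makes the second components cluster at some `t`, and continuity gives `α s = β t`.
  set F : Filter (ℝ × ℝ) := (𝓝[>] s ×ˢ 𝓟 (Icc 0 1)) ⊓ 𝓟 {x | α x.1 = β x.2} with hF
  have hFne : F.NeBot := by
    rw [hF, ← frequently_mem_iff_neBot]
    intro hc
    refine hfreq ?_
    obtain ⟨pa, hpa, pb, hpb, hpp⟩ := eventually_prod_iff.1 hc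
    filter_upwards [hpa] with x hx
    rintro ⟨t, ht, hxt⟩
    exact hpp hx (eventually_principal.1 hpb t ht) hxt.symm
  have hF1 : Tendsto Prod.fst F (𝓝[>] s) := tendsto_fst.mono_left inf_le_left
  have hF2 : Tendsto Prod.snd F (𝓟 (Icc 0 1)) := tendsto_snd.mono_left inf_le_left
  obtain ⟨t, ht, hct⟩ := isCompact_Icc (f := map Prod.snd F) hF2
  set F' : Filter (ℝ × ℝ) := F ⊓ comap Prod.snd (𝓝 t) with hF'
  have hF'ne : F'.NeBot := by
    have h1 : (𝓝 t ⊓ map Prod.snd F).NeBot := hct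
    rw [inf_comm, ← Filter.push_pull] at h1
    exact h1.of_map
  have e1 : Tendsto Prod.fst F' (𝓝[>] s) := hF1.mono_left inf_le_left
  have e2 : Tendsto Prod.snd F' (𝓝[Icc 0 1] t) :=
    tendsto_inf.2 ⟨tendsto_comap.mono_left inf_le_right, hF2.mono_left inf_le_left⟩
  have e3 : ∀ᶠ x in F', α x.1 = β x.2 := by
    have : F' ≤ 𝓟 {x | α x.1 = β x.2} := inf_le_left.trans inf_le_right
    exact le_principal_iff.1 this
  have hαs : Tendsto α (𝓝[>] s) (𝓝 (α s)) := by
    have h1 := hα.analytic.continuousOn s ⟨hs.1, hs.2.le⟩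
    exact h1.tendsto.mono_left (nhdsWithin_le_of_mem
      (mem_of_superset (Ioo_mem_nhdsGT hs.2) fun x hx => ⟨hs.1.trans hx.1.le, hx.2.le⟩))
  have h0 : α s = β t := by
    refine tendsto_nhds_unique_of_eventuallyEq (hαs.comp e1)
      ((hβ.analytic.continuousOn t ht).tendsto.comp e2) e3
  -- Otherwise `α` would take the value `β t = α s` again at parameters just after `s`. Hence the
  -- meeting parameters of `β` accumulate at `t` from the left or from the right.
  have e4 : ∀ᶠ x in F', x.2 ≠ t := by
    have h1 : ∀ᶠ x in 𝓝[>] s, α x ≠ α s := by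
      have := eventually_ne_right hα hs
      rw [← map_add_nhdsGT s, eventually_map]
      simpa using this
    filter_upwards [e1.eventually h1, e3] with x h1 h2 h3
    exact h1 (by rw [h2, h3, h0])
  have e5 : ∃ᶠ x in F', α x.1 = β x.2 ∧ (t < x.2 ∨ x.2 < t) ∧ x.2 ∈ Icc (0 : ℝ) 1 := by
    refine Eventually.frequently ?_
    filter_upwards [e3, e4, e2.eventually self_mem_nhdsWithin] with x h1 h2 h3
    exact ⟨h1, h2.lt_or_gt.symm, h3⟩
  have e2' : Tendsto Prod.snd F' (𝓝 t) := e2.mono_right nhdsWithin_le_nhds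
  have e6 : (∃ᶠ x in F', α x.1 = β x.2 ∧ t < x.2 ∧ x.2 ∈ Icc (0 : ℝ) 1) ∨
      ∃ᶠ x in F', α x.1 = β x.2 ∧ x.2 < t ∧ x.2 ∈ Icc (0 : ℝ) 1 := by
    rw [← frequently_or_distrib]
    refine e5.mono fun x hx => ?_
    rcases hx with ⟨h1, h2 | h2, h3⟩
    · exact Or.inl ⟨h1, h2, h3⟩
    · exact Or.inr ⟨h1, h2, h3⟩
  have lift : ∀ T : Set ℝ, (∃ᶠ x in F', α x.1 = β x.2 ∧ x.2 ∈ T ∧ x.2 ∈ Icc (0 : ℝ) 1) →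
      ∃ᶠ x in 𝓝[>] s ×ˢ 𝓝[T] t, α x.1 = β x.2 := by
    intro T hT
    have hne : (F' ⊓ 𝓟 {x | x.2 ∈ T}).NeBot := by
      rw [← frequently_mem_iff_neBot]
      exact hT.mono fun x hx => hx.2.1
    have h1 : ∃ᶠ x in F' ⊓ 𝓟 {x | x.2 ∈ T}, α x.1 = β x.2 :=
      (e3.filter_mono inf_le_left).frequently
    refine h1.filter_mono (le_prod.2 ⟨e1.mono_left inf_le_left, ?_⟩)
    refine tendsto_inf.2 ⟨e2'.mono_left inf_le_left, tendsto_principal.2 ?_⟩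
    exact mem_inf_of_right (mem_principal_self _)
  rcases e6 with e6 | e6
  · obtain ⟨x, -, h2, h3⟩ := e6.exists
    exact eventually_mem_image_of_frequently hα hβ hs ⟨ht.1, h2.trans_le h3.2⟩ h0
      (lift (Ioi t) e6)
  · obtain ⟨x, -, h2, h3⟩ := e6.exists
    have := lift (Iio t) e6
    -- Meetings to the left of `t` are meetings to the right of `1 - t` for the reversed arc.
    rw [← image_reverse]
    refine eventually_mem_image_of_frequently hα hβ.reverse (t := 1 - t) hs
      ⟨by linarith [ht.2], by linarith [h3.1]⟩ (by simpa using h0) ?_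
    rw [← map_one_sub_nhdsLT, ← Filter.map_id (f := 𝓝[>] s), prod_map_map_eq, frequently_map]
    simpa using this

theorem tame_left [T2Space M] {α β : ℝ → M} (hα : IsAnalyticArc d α 0 1)
    (hβ : IsAnalyticArc d β 0 1) {s : ℝ} (hs : s ∈ Ioc (0 : ℝ) 1) :
    (∀ᶠ x in 𝓝[<] s, α x ∈ β '' Icc 0 1) ∨ ∀ᶠ x in 𝓝[<] s, α x ∉ β '' Icc 0 1 := by
  have := tame_right hα.reverse hβ (s := 1 - s) ⟨by linarith [hs.2], by linarith [hs.1]⟩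
  rw [← map_one_sub_nhdsLT, eventually_map, eventually_map] at this
  simpa only [sub_sub_cancel] using this

/-- Infinitely many frontier points would accumulate from one side at some `x`. On that side `α` is
eventually inside or eventually outside the image of `β` (`tame_left`, `tame_right`), and an open
interval of either kind contains no frontier points. -/
theorem finite_frontier [T2Space M] {α β : ℝ → M} (hα : IsAnalyticArc d α 0 1)
    (hβ : IsAnalyticArc d β 0 1) :
    (Ioo (0 : ℝ) 1 ∩ frontier (α ⁻¹' (β '' Icc 0 1))).Finite := by
  set S := α ⁻¹' (β '' Icc 0 1) with hS
  by_contra hinf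
  obtain ⟨x, -, hacc⟩ := Set.Infinite.exists_accPt_of_subset_isCompact (K := Icc (0 : ℝ) 1) hinf
    isCompact_Icc (inter_subset_left.trans Ioo_subset_Icc_self)
  rw [accPt_iff_frequently_nhdsNE, ← Iio_union_Ioi, nhdsWithin_union, frequently_sup] at hacc
  have key : ∀ T : Set ℝ, IsOpen T → ((∀ᶠ y in 𝓝[T] x, y ∈ S) ∨ ∀ᶠ y in 𝓝[T] x, y ∉ S) →
      ∀ᶠ y in 𝓝[T] x, y ∉ frontier S := by
    rintro T hT (h | h)
    · filter_upwards [eventually_eventually_nhdsWithin.2 h, self_mem_nhdsWithin] with y hy hyT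
      rw [hT.nhdsWithin_eq hyT] at hy
      exact fun hf => hf.2 (mem_interior_iff_mem_nhds.2 hy)
    · filter_upwards [eventually_eventually_nhdsWithin.2 h, self_mem_nhdsWithin] with y hy hyT
      rw [hT.nhdsWithin_eq hyT] at hy
      rw [← frontier_compl]
      exact fun hf => hf.2 (mem_interior_iff_mem_nhds.2 hy)
  rcases hacc with h | h
  · obtain ⟨y, hy, hyx⟩ := (h.and_eventually self_mem_nhdsWithin).exists
    have hx1 : x ≤ 1 := by
      by_contra hx
      obtain ⟨y, hy, hy'⟩ := (h.and_eventually
        (nhdsWithin_le_nhds (lt_mem_nhds (not_le.1 hx)))).exists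
      exact absurd hy.1.2 (not_lt.2 (le_of_lt hy'))
    obtain ⟨y, hy, hy'⟩ := (h.and_eventually
      (key _ isOpen_Iio (tame_left hα hβ ⟨hy.1.1.trans hyx, hx1⟩))).exists
    exact hy' hy.2
  · have hx0 : 0 ≤ x := by
      by_contra hx
      obtain ⟨y, hy, hy'⟩ := (h.and_eventually
        (nhdsWithin_le_nhds (gt_mem_nhds (not_le.1 hx)))).exists
      exact absurd hy.1.1 (not_lt.2 (le_of_lt hy'))
    obtain ⟨y, hy, hyx⟩ := (h.and_eventually self_mem_nhdsWithin).exists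
    obtain ⟨y, hy, hy'⟩ := (h.and_eventually
      (key _ isOpen_Ioi (tame_right hα hβ ⟨hx0, lt_trans hyx hy.1.2⟩))).exists
    exact hy' hy.2

end Arcs

/-! ### Arcs with the same image define the same path up to orientation. -/

section Reparametrization

open Filter Topology Set

variable {d : ℕ} {M : Type u} [TopologicalSpace M] [ChartedSpace (EuclideanSpace ℝ (Fin d)) M]

theorem IsAnalyticArc.analyticAt_chart {α : ℝ → M} {a b s : ℝ} (h : IsAnalyticArc d α a b)
    (hs : s ∈ Ioo a b) : AnalyticAt ℝ (fun t => extChartAt (𝓡 d) (α s) (α t)) s ∧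
      deriv (fun t => extChartAt (𝓡 d) (α s) (α t)) s ≠ 0 := by
  have h1 : ContMDiffAt 𝓘(ℝ, ℝ) (𝓡 d) ω α s :=
    h.analytic.contMDiffAt (Icc_mem_nhds hs.1 hs.2)
  constructor
  · have h2 := (contMDiffAt_iff.1 h1).2
    simp only [mfld_simps, contDiffWithinAt_univ] at h2
    exact h2.analyticAt
  · intro h0
    refine h.immersion s hs ?_
    have hd : MDifferentiableAt 𝓘(ℝ, ℝ) (𝓡 d) α s := h1.mdifferentiableAt (by simp)
    have h3 : fderivWithin ℝ (writtenInExtChartAt 𝓘(ℝ, ℝ) (𝓡 d) s α) (range 𝓘(ℝ, ℝ))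
        (extChartAt 𝓘(ℝ, ℝ) s s) = 0 := by
      simp only [writtenInExtChartAt, mfld_simps, fderivWithin_univ]
      refine ContinuousLinearMap.ext fun v => ?_
      change fderiv ℝ (fun t => extChartAt (𝓡 d) (α s) (α t)) s v = 0
      rw [← toSpanSingleton_deriv, h0]; simp
    exact hd.mfderiv.trans h3

/-- A change of parameter between two arcs is analytic with nonvanishing derivative. -/
theorem analyticAt_changeOfParameter {α β : ℝ → M} {a b a' b' : ℝ} (hα : IsAnalyticArc d α a b)
    (hβ : IsAnalyticArc d β a' b') {φ : ℝ → ℝ} {s : ℝ} (hs : s ∈ Ioo a b)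
    (hφs : φ s ∈ Ioo a' b') (hφ : ContinuousAt φ s) (h : ∀ᶠ t in 𝓝 s, β (φ t) = α t) :
    AnalyticAt ℝ φ s ∧ deriv φ s ≠ 0 := by
  obtain ⟨ha, ha'⟩ := hα.analyticAt_chart hs
  obtain ⟨hb, hb'⟩ := hβ.analyticAt_chart hφs
  rw [h.self_of_nhds] at hb hb'
  set x : M → EuclideanSpace ℝ (Fin d) := ↑(extChartAt (𝓡 d) (α s))
  -- The functional turns `β` into a scalar function with nonzero derivative at `φ s`; its analytic
  -- local inverse expresses `φ` through `α`.
  obtain ⟨l, hl⟩ := SeparatingDual.exists_ne_zero (R := ℝ) hb'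
  have hf : AnalyticAt ℝ (fun t => l (x (β t))) (φ s) := (l.analyticAt _).comp hb
  have hf' : deriv (fun t => l (x (β t))) (φ s) ≠ 0 := by
    have := (l.hasFDerivAt.comp_hasDerivAt (φ s) hb.differentiableAt.hasDerivAt).deriv
    rw [Function.comp_def] at this
    rwa [this]
  have hinv := hf.analyticAt_localInverse hf'
  have hleft := hf.hasStrictDerivAt.eventually_left_inverse hf'
  set S := hf.hasStrictDerivAt.localInverse _ _ _ hf'
  have heq : φ =ᶠ[𝓝 s] fun t => S (l (x (α t))) := by
    filter_upwards [hφ.eventually hleft, h] with t h1 h2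
    rw [← h2, h1]
  have hφa : AnalyticAt ℝ φ s := by
    refine AnalyticAt.congr ?_ heq.symm
    refine AnalyticAt.fun_comp (g := S) ?_ ((l.analyticAt _).comp ha)
    rwa [h.self_of_nhds] at hinv
  refine ⟨hφa, fun h0 => ha' ?_⟩
  have h1 : (fun t => x (α t)) =ᶠ[𝓝 s] (fun t => x (β t)) ∘ φ := by
    filter_upwards [h] with t ht
    simp [ht]
  rw [h1.deriv_eq, deriv.scomp s hb.differentiableAt hφa.differentiableAt, h0, zero_smul]

/-- The endpoints agree only propositionally. Speaking of membership in an arbitrary `L` instead of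
equality of arrows avoids transport along these equalities. -/
theorem Curve.toPath_mem_of_reparam {L : Subgroupoid (PathGroupoid d M)} {x y x' y' : M}
    (c : Curve d x y) (c' : Curve d x' y') {φ : ℝ → ℝ} (hφ : IsReparametrization φ)
    (h : ∀ t ∈ Icc (0 : ℝ) 1, c'.1.extend t = c.1.extend (φ t)) :
    c.toPath ∈ L.arrows x y ↔ c'.toPath ∈ L.arrows x' y' := by
  have h0 : x' = x := by simpa [hφ.map_zero] using h 0 (by simp)
  have h1 : y' = y := by simpa [hφ.map_one] using h 1 (by simp)
  subst h0 h1
  have : c'.toPath = c.toPath := Quotient.sound (CurveEquiv.reparam c c' φ hφ h)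
  rw [this]

theorem isReparametrization_id : IsReparametrization id :=
  ⟨continuousOn_id, rfl, rfl, .single ⟨le_rfl, one_pos, le_rfl, contDiff_id.contDiffOn,
    fun t _ => by simp⟩⟩

/-- Arcs with the same image, run through in the same direction, define the same path. -/
theorem Curve.toPath_mem_of_strictMonoOn [T2Space M] {L : Subgroupoid (PathGroupoid d M)}
    {x y x' y' : M} (c : Curve d x y) (c' : Curve d x' y')
    (hc : IsAnalyticArc d c.1.extend 0 1) (hc' : IsAnalyticArc d c'.1.extend 0 1)
    {φ : ℝ → ℝ} (hφ : StrictMonoOn φ (Ioo 0 1)) (hmaps : MapsTo φ (Ioo 0 1) (Ioo 0 1))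
    (hsurj : SurjOn φ (Ioo 0 1) (Ioo 0 1))
    (h : ∀ t ∈ Ioo (0 : ℝ) 1, c.1.extend (φ t) = c'.1.extend t) :
    c.toPath ∈ L.arrows x y ↔ c'.toPath ∈ L.arrows x' y' := by
  -- Extended by the identity, `φ` is monotone and surjective on the line, hence continuous, in
  -- particular at `0` and `1`.
  set f : ℝ → ℝ := fun t => if t ∈ Ioo (0 : ℝ) 1 then φ t else t with hf
  have hf1 : ∀ t ∈ Ioo (0 : ℝ) 1, f t = φ t := fun t ht => if_pos ht
  have hf2 : ∀ t ∉ Ioo (0 : ℝ) 1, f t = t := fun t ht => if_neg ht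
  have hmono : Monotone f := by
    intro s t hst
    by_cases hs : s ∈ Ioo (0 : ℝ) 1 <;> by_cases ht : t ∈ Ioo (0 : ℝ) 1
    · rw [hf1 s hs, hf1 t ht]; exact hφ.monotoneOn hs ht hst
    · rw [hf1 s hs, hf2 t ht]
      have : 1 ≤ t := by by_contra hlt; exact ht ⟨hs.1.trans_le hst, not_le.1 hlt⟩
      exact (hmaps hs).2.le.trans this
    · rw [hf2 s hs, hf1 t ht]
      have : s ≤ 0 := by by_contra hlt; exact hs ⟨not_le.1 hlt, hst.trans_lt ht.2⟩
      exact this.trans (hmaps ht).1.le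
    · rwa [hf2 s hs, hf2 t ht]
  have hsurj' : Function.Surjective f := by
    intro t
    by_cases ht : t ∈ Ioo (0 : ℝ) 1
    · obtain ⟨s, hs, hst⟩ := hsurj ht
      exact ⟨s, by rw [hf1 s hs, hst]⟩
    · exact ⟨t, hf2 t ht⟩
  have hcont : Continuous f := hmono.continuous_of_surjective hsurj'
  have hfeq : ∀ t ∈ Ioo (0 : ℝ) 1, c.1.extend (f t) = c'.1.extend t := fun t ht => by
    rw [hf1 t ht, h t ht]
  refine Curve.toPath_mem_of_reparam c c' (φ := f)
    ⟨hcont.continuousOn, hf2 0 (by simp), hf2 1 (by simp), .single ⟨le_rfl, one_pos, le_rfl, ?_⟩⟩ ?_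
  · have key : ∀ t ∈ Ioo (0 : ℝ) 1, AnalyticAt ℝ f t ∧ deriv f t ≠ 0 := fun t ht =>
      analyticAt_changeOfParameter hc' hc ht (by rw [hf1 t ht]; exact hmaps ht)
        hcont.continuousAt (by
          filter_upwards [Ioo_mem_nhds ht.1 ht.2] with s hs using hfeq s hs)
    exact ⟨fun t ht => (key t ht).1.contDiffAt.contDiffWithinAt, fun t ht =>
      lt_of_le_of_ne hmono.deriv_nonneg (key t ht).2.symm⟩
  · have := Set.EqOn.closure (s := Ioo (0 : ℝ) 1) hfeq
      (c.1.continuous_extend.comp hcont) c'.1.continuous_extend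
    rw [closure_Ioo zero_ne_one] at this
    exact fun t ht => (this ht).symm

theorem Curve.symm_toPath_mem {L : Subgroupoid (PathGroupoid d M)} {x y : M} (c : Curve d x y) :
    c.symm.toPath ∈ L.arrows y x ↔ c.toPath ∈ L.arrows x y :=
  L.inv_mem_iff c.toPath

/-- Arcs with the same image define the same path up to orientation. -/
theorem Curve.toPath_mem_of_image_eq [T2Space M] {L : Subgroupoid (PathGroupoid d M)}
    {x y x' y' : M} (c : Curve d x y) (c' : Curve d x' y')
    (hc : IsAnalyticArc d c.1.extend 0 1) (hc' : IsAnalyticArc d c'.1.extend 0 1)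
    (h : c.1.extend '' Ioo 0 1 = c'.1.extend '' Ioo 0 1)
    (hmem : c.toPath ∈ L.arrows x y) : c'.toPath ∈ L.arrows x' y' := by
  have h1 : ∀ t : ℝ, ∃ s : ℝ, t ∈ Ioo (0 : ℝ) 1 → s ∈ Ioo (0 : ℝ) 1 ∧
      c.1.extend s = c'.1.extend t := by
    intro t
    by_cases ht : t ∈ Ioo (0 : ℝ) 1
    · obtain ⟨s, hs, hst⟩ := h.ge (mem_image_of_mem _ ht)
      exact ⟨s, fun _ => ⟨hs, hst⟩⟩
    · exact ⟨0, fun h => absurd h ht⟩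
  -- On `]0,1[`, `φ` is `c⁻¹ ∘ c'` (inverse map), continuous because `c` is an embedding there. As a
  -- continuous injection of an interval it is strictly monotone; in the decreasing case `c` is
  -- replaced by its reversal.
  choose φ hφ using h1
  have hmaps : MapsTo φ (Ioo 0 1) (Ioo 0 1) := fun t ht => (hφ t ht).1
  have hinj : InjOn φ (Ioo 0 1) := by
    intro s hs t ht hst
    refine hc'.injOn hs ht ?_
    rw [← (hφ s hs).2, ← (hφ t ht).2, hst]
  have hsurj : SurjOn φ (Ioo 0 1) (Ioo 0 1) := by
    intro s hs
    obtain ⟨t, ht, hst⟩ := h.le (mem_image_of_mem _ hs)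
    exact ⟨t, ht, hc.injOn (hmaps ht) hs (by rw [(hφ t ht).2, hst])⟩
  have hcont : ContinuousOn φ (Ioo 0 1) := by
    rw [continuousOn_iff_continuous_domRestrict]
    have h2 : Continuous (hmaps.restrict) := by
      rw [hc.embedding.isInducing.continuous_iff]
      have : (Ioo (0 : ℝ) 1).domRestrict c.1.extend ∘ hmaps.restrict =
          (Ioo (0 : ℝ) 1).domRestrict c'.1.extend := funext fun t => (hφ t.1 t.2).2
      rw [this]
      exact hc'.embedding.continuous
    exact continuous_subtype_val.comp h2
  rcases hcont.strictMonoOn_of_injOn_Ioo one_pos hinj with hmono | hanti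
  · exact (Curve.toPath_mem_of_strictMonoOn c c' hc hc' hmono hmaps hsurj
      fun t ht => (hφ t ht).2).1 hmem
  · have hsymm : c.symm.1.extend = fun t => c.1.extend (1 - t) :=
      funext fun t => Path.extend_symm_apply c.1 t
    refine (Curve.toPath_mem_of_strictMonoOn c.symm c' (by rw [hsymm]; exact hc.reverse) hc'
      (φ := fun t => 1 - φ t) ?_ ?_ ?_ ?_).1 (c.symm_toPath_mem.2 hmem)
    · intro s hs t ht hst
      have := hanti hs ht hst
      simp only; linarith
    · intro t ht
      exact ⟨by linarith [(hmaps ht).2], by linarith [(hmaps ht).1]⟩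
    · intro s hs
      obtain ⟨t, ht, hst⟩ := hsurj (a := 1 - s) ⟨by linarith [hs.2], by linarith [hs.1]⟩
      exact ⟨t, ht, by simp [hst]⟩
    · intro t ht
      rw [hsymm, ← (hφ t ht).2]
      simp

end Reparametrization

/-! ### Decomposition of curves into segments. -/

section Segments

open Set

variable {d : ℕ} {M : Type u} [TopologicalSpace M] [ChartedSpace (EuclideanSpace ℝ (Fin d)) M]

theorem transGen_lt {P : ℝ → ℝ → Prop} {a b : ℝ}
    (h : Relation.TransGen (fun a b => 0 ≤ a ∧ a < b ∧ b ≤ 1 ∧ P a b) a b) :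
    0 ≤ a ∧ a < b ∧ b ≤ 1 := by
  induction h with
  | single h => exact ⟨h.1, h.2.1, h.2.2.1⟩
  | tail _ h ih => exact ⟨ih.1, ih.2.1.trans h.2.1, h.2.2.1⟩

theorem transGen_restrict {P : ℝ → ℝ → Prop} {a b : ℝ}
    (h : Relation.TransGen (fun a b => 0 ≤ a ∧ a < b ∧ b ≤ 1 ∧ P a b) a b) :
    Relation.TransGen (fun u v => a ≤ u ∧ u < v ∧ v ≤ b ∧ P u v) a b := by
  induction h with
  | single h => exact .single ⟨le_rfl, h.2.1, le_rfl, h.2.2.2⟩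
  | tail h1 h ih =>
    refine Relation.TransGen.tail (Relation.TransGen.mono (fun u v h2 => ⟨h2.1, h2.2.1,
      h2.2.2.1.trans h.2.1.le, h2.2.2.2⟩) _ _ ih) ⟨(transGen_lt h1).2.1.le, h.2.1, le_rfl, h.2.2.2⟩

/-- The affinely parametrized restriction of a path to the interval `[a,b]`. -/
def segmentPath {x y : M} (c : Path x y) (a b : ℝ) : Path (c.extend a) (c.extend b) where
  toFun t := c.extend ((b - a) * t + a)
  continuous_toFun := c.continuous_extend.comp (by fun_prop)
  source' := by simp
  target' := by simp

theorem segmentPath_extend {x y : M} (c : Path x y) (a b : ℝ) {t : ℝ} (ht : t ∈ Icc (0 : ℝ) 1) :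
    (segmentPath c a b).extend t = c.extend ((b - a) * t + a) := by
  rw [Path.extend_apply _ ht]; rfl

/-- The part of a curve between two nodes of a partition. -/
def Curve.segment {x y : M} (c : Curve d x y) (a b : ℝ)
    (h : Relation.TransGen (fun a b => 0 ≤ a ∧ a < b ∧ b ≤ 1 ∧ IsPiece d c.1.extend a b) a b) :
    Curve d (c.1.extend a) (c.1.extend b) :=
  ⟨segmentPath c.1 a b, by
    have hab : 0 < b - a := sub_pos.2 (transGen_lt h).2.1
    have h2 := Relation.TransGen.lift (r := fun u v => a ≤ u ∧ u < v ∧ v ≤ b ∧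
        IsPiece d c.1.extend u v)
      (p := fun u v => 0 ≤ u ∧ u < v ∧ v ≤ 1 ∧ IsPiece d (segmentPath c.1 a b).extend u v)
      (fun t : ℝ => (t - a) / (b - a)) ?_ a b (transGen_restrict h)
    · simpa [Function.onFun, Piecewise, hab.ne'] using h2
    · rintro u v ⟨h0, h1, h2, h3⟩
      have huv : (u - a) / (b - a) < (v - a) / (b - a) := by gcongr
      have hu0 : 0 ≤ (u - a) / (b - a) := div_nonneg (by linarith) hab.le
      have hv1 : (v - a) / (b - a) ≤ 1 := (div_le_one hab).2 (by linarith)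
      refine ⟨hu0, huv, hv1, ?_⟩
      refine h3.comp_affine (b - a) a hab.ne' _ _ ?_ ?_ huv ?_
      · intro t ht
        have e1 := (div_le_iff₀ hab).1 ht.1
        have e2 := (le_div_iff₀ hab).1 ht.2
        constructor <;> linarith
      · intro t ht
        have e1 := (div_lt_iff₀ hab).1 ht.1
        have e2 := (lt_div_iff₀ hab).1 ht.2
        constructor <;> linarith
      · intro t ht
        exact segmentPath_extend _ _ _ ⟨hu0.trans ht.1, ht.2.trans hv1⟩⟩

/-- The piecewise linear map which is linear on `[0,1/2]` and `[1/2,1]` and maps `1/2` to `r`. -/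
def bisectParam (r t : ℝ) : ℝ :=
  if t ≤ 1 / 2 then 2 * r * t else 2 * (1 - r) * t + (2 * r - 1)

theorem isReparametrization_bisectParam {r : ℝ} (h0 : 0 < r) (h1 : r < 1) :
    IsReparametrization (bisectParam r) := by
  have key : ∀ (a b k l : ℝ), 0 < k → (∀ t ∈ Ioo a b, bisectParam r t = k * t + l) →
      ContDiffOn ℝ ω (bisectParam r) (Ioo a b) ∧
        ∀ t ∈ Ioo a b, 0 < deriv (bisectParam r) t := by
    intro a b k l hk h
    constructor
    · refine ContDiffOn.congr (f := fun t => k * t + l) ?_ h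
      fun_prop
    · intro t ht
      have hev : bisectParam r =ᶠ[nhds t] fun t => k * t + l := by
        filter_upwards [Ioo_mem_nhds ht.1 ht.2] with s hs using h s hs
      rw [hev.deriv_eq]
      have := (((hasDerivAt_id t).const_mul k).add_const l).deriv
      simp only [id, mul_one] at this
      rw [this]; exact hk
  refine ⟨Continuous.continuousOn ?_, by norm_num [bisectParam], ?_, ?_⟩
  · unfold bisectParam
    refine Continuous.if_le (by fun_prop) (by fun_prop) (by fun_prop) (by fun_prop) ?_
    intro t ht; rw [ht]; ring
  · unfold bisectParam
    rw [if_neg (by norm_num)]; ring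
  · refine (Relation.TransGen.single (b := 1 / 2) ?_).tail (c := 1) ?_
    · refine ⟨le_rfl, by norm_num, by norm_num, key _ _ (2 * r) 0 (by linarith) ?_⟩
      intro t ht
      simp only [bisectParam, if_pos ht.2.le, add_zero]
    · refine ⟨by norm_num, by norm_num, by norm_num, key _ _ (2 * (1 - r)) (2 * r - 1)
        (by linarith) ?_⟩
      intro t ht
      simp only [bisectParam, if_neg (not_le.2 ht.1)]

variable {L : Subgroupoid (PathGroupoid d M)}

/-- The concatenation passes `b` at parameter `1/2`, the affine segment from `a` to `e` at `(b - a)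
/ (e - a)`; `bisectParam` with this value is the change of parameter. -/
theorem Curve.segment_mem_trans {x y : M} (c : Curve d x y) {a b e : ℝ}
    (hab : Relation.TransGen (fun a b => 0 ≤ a ∧ a < b ∧ b ≤ 1 ∧ IsPiece d c.1.extend a b) a b)
    (hbe : Relation.TransGen (fun a b => 0 ≤ a ∧ a < b ∧ b ≤ 1 ∧ IsPiece d c.1.extend a b) b e)
    (h1 : (c.segment a b hab).toPath ∈ L.arrows _ _)
    (h2 : (c.segment b e hbe).toPath ∈ L.arrows _ _) :
    (c.segment a e (hab.trans hbe)).toPath ∈ L.arrows _ _ := by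
  obtain ⟨ha0, hlt, hb1⟩ := transGen_lt hab
  obtain ⟨hb0, hlt', he1⟩ := transGen_lt hbe
  have hr0 : 0 < (b - a) / (e - a) := div_pos (by linarith) (by linarith)
  have hr1 : (b - a) / (e - a) < 1 := (div_lt_one (by linarith)).2 (by linarith)
  have hea : e - a ≠ 0 := by linarith
  have h3 : ((c.segment a b hab).trans (c.segment b e hbe)).toPath ∈ L.arrows _ _ := L.mul h1 h2
  refine (Curve.toPath_mem_of_reparam _ _ (isReparametrization_bisectParam hr0 hr1) ?_).2 h3
  intro t ht
  change ((segmentPath c.1 a b).trans (segmentPath c.1 b e)).extend t =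
    (segmentPath c.1 a e).extend _
  unfold bisectParam
  split_ifs with h
  · rw [Path.extend_trans_of_le_half _ _ h, segmentPath_extend _ _ _ ⟨by linarith [ht.1],
      by linarith⟩, segmentPath_extend]
    · congr 1; field_simp
    · constructor
      · have := ht.1; positivity
      · nlinarith
  · push Not at h
    rw [Path.extend_trans_of_half_le _ _ h.le, segmentPath_extend _ _ _ ⟨by linarith,
      by linarith [ht.2]⟩, segmentPath_extend]
    · congr 1; field_simp; ring
    · constructor
      · nlinarith
      · nlinarith [ht.2]

/-- A curve whose pieces for some partition define paths in a subgroupoid defines a path in this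
subgroupoid. -/
theorem Curve.toPath_mem_of_chain {x y : M} (c : Curve d x y) {R : ℝ → ℝ → Prop}
    (hR : ∀ a b, R a b → 0 ≤ a ∧ a < b ∧ b ≤ 1 ∧ IsPiece d c.1.extend a b)
    (hmem : ∀ a b (h : R a b), (c.segment a b (.single (hR a b h))).toPath ∈ L.arrows _ _)
    (h : Relation.TransGen R 0 1) : c.toPath ∈ L.arrows x y := by
  have key : ∀ b (h : Relation.TransGen R 0 b),
      (c.segment 0 b (Relation.TransGen.mono hR _ _ h)).toPath ∈ L.arrows _ _ := by
    intro b h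
    induction h with
    | single h => exact hmem _ _ h
    | tail h1 h2 ih => exact c.segment_mem_trans (Relation.TransGen.mono hR _ _ h1) (.single (hR _ _ h2)) ih (hmem _ _ h2)
  refine (Curve.toPath_mem_of_reparam c _ isReparametrization_id ?_).2 (key 1 h)
  intro t ht
  refine (segmentPath_extend c.1 0 1 ht).trans ?_
  simp

theorem Curve.isAnalyticArc_segment {x y : M} (c : Curve d x y) {a b : ℝ} (hab : a < b)
    (h : IsAnalyticArc d c.1.extend a b) (h') :
    IsAnalyticArc d (c.segment a b h').1.extend 0 1 := by
  refine h.comp_affine (b - a) a (by linarith) 0 1 ?_ ?_ fun t ht => segmentPath_extend _ _ _ ht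
  · intro t ht; constructor <;> nlinarith [ht.1, ht.2]
  · intro t ht; constructor <;> nlinarith [ht.1, ht.2]

theorem Curve.image_segment_Ioo {x y : M} (c : Curve d x y) {a b : ℝ} (hab : a < b) (h') :
    (c.segment a b h').1.extend '' Ioo 0 1 = c.1.extend '' Ioo a b := by
  have hba : 0 < b - a := sub_pos.2 hab
  ext z
  constructor
  · rintro ⟨t, ht, rfl⟩
    refine ⟨(b - a) * t + a, ⟨by nlinarith [ht.1], by nlinarith [ht.2]⟩, ?_⟩
    exact (segmentPath_extend c.1 a b ⟨ht.1.le, ht.2.le⟩).symm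
  · rintro ⟨t, ht, rfl⟩
    have h1 : (t - a) / (b - a) ∈ Ioo (0 : ℝ) 1 :=
      ⟨div_pos (by linarith [ht.1]) hba, (div_lt_one hba).2 (by linarith [ht.2])⟩
    refine ⟨(t - a) / (b - a), h1, ?_⟩
    refine (segmentPath_extend c.1 a b ⟨h1.1.le, h1.2.le⟩).trans ?_
    congr 1; field_simp; ring

theorem Curve.range_segment {x y : M} (c : Curve d x y) {a b : ℝ} (hab : a < b) (h') :
    range (c.segment a b h').1 ⊆
      c.1.extend '' Ioo a b ∪ {c.1.extend a, c.1.extend b} := by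
  have hba : 0 < b - a := sub_pos.2 hab
  rintro _ ⟨t, rfl⟩
  rcases eq_or_lt_of_le t.2.1 with h0 | h0
  · right; left
    change c.1.extend ((b - a) * t + a) = _
    rw [← h0]; simp
  rcases eq_or_lt_of_le t.2.2 with h1 | h1
  · right; right
    change c.1.extend ((b - a) * t + a) = _
    rw [h1]; simp
  · left
    exact ⟨(b - a) * t + a, ⟨by nlinarith, by nlinarith⟩, rfl⟩

/-- Every path is a product of edges. -/
theorem Curve.toPath_mem_of_edges (hid : ∀ x : M, (Curve.refl (d := d) x).toPath ∈ L.arrows x x)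
    (hedge : ∀ (x y : M) (c : Curve d x y), IsAnalyticArc d c.1.extend 0 1 →
      c.toPath ∈ L.arrows x y) {x y : M} (c : Curve d x y) : c.toPath ∈ L.arrows x y := by
  refine c.toPath_mem_of_chain (fun a b h => h) ?_ c.2
  rintro a b h
  rcases h.2.2.2 with h' | h'
  · exact hedge _ _ _ (c.isAnalyticArc_segment h.2.1 h' _)
  -- A constant piece is an identity arrow.
  · refine (Curve.toPath_mem_of_reparam (Curve.refl (c.1.extend a)) _
      isReparametrization_id ?_).1 (hid _)
    intro t ht
    refine (segmentPath_extend c.1 a b ht).trans ?_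
    refine (h' _ ⟨by nlinarith [ht.1, h.2.1], by nlinarith [ht.2, h.2.1]⟩).trans ?_
    change _ = (Path.refl (c.1.extend a)).extend _
    simp

end Segments

/-! ### Cutting finitely many arcs into cells; construction of an independent set. -/

section Cells

open Set

/-- The interior of `t` and the complement of its closure are disjoint open sets covering everything
off the frontier. -/
theorem subset_of_disjoint_frontier {X : Type*} [TopologicalSpace X] {s t : Set X}
    (hs : _root_.IsPreconnected s) (h : Disjoint s (frontier t)) (hne : (s ∩ t).Nonempty) :
    s ⊆ t := by
  have hint : ∀ x ∈ s, x ∈ closure t → x ∈ interior t := fun x hx hxt => by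
    by_contra hn
    exact disjoint_left.1 h hx ⟨hxt, hn⟩
  obtain ⟨x, hx, hxt⟩ := hne
  refine (hs.subset_left_of_subset_union isOpen_interior isClosed_closure.isOpen_compl
    (disjoint_left.2 fun y hy hy' => hy' (subset_closure (interior_subset hy)))
    (fun y hy => ?_) ⟨x, hx, hint x hx (subset_closure hxt)⟩).trans interior_subset
  by_cases hyt : y ∈ closure t
  · exact Or.inl (hint y hy hyt)
  · exact Or.inr hyt

/-- Induction on the number of nodes strictly between: any such node splits the interval into two
with fewer nodes inside. -/
theorem transGen_consecutive {N : Set ℝ} (hN : N.Finite) {a b : ℝ} (ha : a ∈ N) (hb : b ∈ N)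
    (hab : a < b) :
    Relation.TransGen (fun u v => u ∈ N ∧ v ∈ N ∧ u < v ∧ ∀ t ∈ Ioo u v, t ∉ N) a b := by
  induction hn : (N ∩ Ioo a b).ncard using Nat.strong_induction_on generalizing a b with
  | _ n ih =>
    by_cases h : ∀ t ∈ Ioo a b, t ∉ N
    · exact .single ⟨ha, hb, hab, h⟩
    · push Not at h
      obtain ⟨t, ht, htN⟩ := h
      have hfin : (N ∩ Ioo a b).Finite := hN.subset inter_subset_left
      have h1 : (N ∩ Ioo a t).ncard < n := by
        rw [← hn]
        refine ncard_lt_ncard ⟨fun s hs => ⟨hs.1, hs.2.1, hs.2.2.trans ht.2⟩, fun hle => ?_⟩ hfin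
        exact lt_irrefl t (hle ⟨htN, ht⟩).2.2
      have h2 : (N ∩ Ioo t b).ncard < n := by
        rw [← hn]
        refine ncard_lt_ncard ⟨fun s hs => ⟨hs.1, ht.1.trans hs.2.1, hs.2.2⟩, fun hle => ?_⟩ hfin
        exact lt_irrefl t (hle ⟨htN, ht⟩).2.1
      exact (ih _ h1 ha htN ht.1 rfl).trans (ih _ h2 htN hb ht.2 rfl)

variable {d : ℕ} {M : Type u} [TopologicalSpace M] [ChartedSpace (EuclideanSpace ℝ (Fin d)) M]

theorem IsAnalyticArc.finite_preimage {α : ℝ → M} (h : IsAnalyticArc d α 0 1) {P : Set M}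
    (hP : P.Finite) : {t | t ∈ Icc (0 : ℝ) 1 ∧ α t ∈ P}.Finite := by
  have h1 : {t | t ∈ Icc (0 : ℝ) 1 ∧ α t ∈ P} ⊆ {0, 1} ∪ (Ioo 0 1 ∩ α ⁻¹' P) := by
    rintro t ⟨ht, htP⟩
    rcases eq_or_lt_of_le ht.1 with h0 | h0
    · exact Or.inl (Or.inl h0.symm)
    rcases eq_or_lt_of_le ht.2 with h1 | h1
    · exact Or.inl (Or.inr h1)
    · exact Or.inr ⟨⟨h0, h1⟩, htP⟩
  refine Set.Finite.subset ((toFinite _).union ?_) h1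
  exact Set.Finite.of_finite_image (hP.subset (by rintro _ ⟨t, ht, rfl⟩; exact ht.2))
    (h.injOn.mono inter_subset_left)

/-- Points of the manifold at which the arcs `α i` have to be cut so that the pieces are pairwise
equal or disjoint. -/
structure IsNodeSet {ι : Type*} (α : ι → ℝ → M) (P : Set M) : Prop where
  finite : P.Finite
  source_mem : ∀ i, α i 0 ∈ P
  target_mem : ∀ i, α i 1 ∈ P
  frontier_mem : ∀ i j, ∀ t ∈ Ioo (0 : ℝ) 1 ∩ frontier (α i ⁻¹' (α j '' Icc 0 1)), α i t ∈ P

theorem exists_isNodeSet [T2Space M] {ι : Type*} [Finite ι] {α : ι → ℝ → M}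
    (hα : ∀ i, IsAnalyticArc d (α i) 0 1) : ∃ P, IsNodeSet α P := by
  refine ⟨(⋃ i, {α i 0, α i 1}) ∪ ⋃ (i) (j),
    α i '' (Ioo (0 : ℝ) 1 ∩ frontier (α i ⁻¹' (α j '' Icc 0 1))), ?_, ?_, ?_, ?_⟩
  · exact (finite_iUnion fun i => toFinite _).union (finite_iUnion fun i => finite_iUnion fun j =>
      (finite_frontier (hα i) (hα j)).image _)
  · exact fun i => Or.inl (mem_iUnion.2 ⟨i, Or.inl rfl⟩)
  · exact fun i => Or.inl (mem_iUnion.2 ⟨i, Or.inr rfl⟩)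
  · exact fun i j t ht => Or.inr (mem_iUnion₂.2 ⟨i, j, mem_image_of_mem _ ht⟩)

/-- `[a,b]` is the interval between two consecutive parameters at which `α` meets `P`. -/
structure IsCell {X : Type*} (α : ℝ → X) (P : Set X) (a b : ℝ) : Prop where
  nonneg : 0 ≤ a
  le_one : b ≤ 1
  lt : a < b
  left_mem : α a ∈ P
  right_mem : α b ∈ P
  notMem : ∀ t ∈ Ioo a b, α t ∉ P

theorem IsCell.mem_Ioo {X : Type*} {α : ℝ → X} {P : Set X} {a b t : ℝ} (h : IsCell α P a b)
    (ht : t ∈ Ioo a b) : t ∈ Ioo (0 : ℝ) 1 :=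
  ⟨h.nonneg.trans_lt ht.1, ht.2.trans_le h.le_one⟩

variable {ι : Type*} {α : ι → ℝ → M} {P : Set M}

theorem IsNodeSet.transGen_isCell (hα : ∀ i, IsAnalyticArc d (α i) 0 1) (hP : IsNodeSet α P)
    (i : ι) : Relation.TransGen (IsCell (α i) P) 0 1 := by
  refine Relation.TransGen.mono ?_ _ _ (transGen_consecutive
    ((hα i).finite_preimage hP.finite) (a := 0) (b := 1) ⟨by simp, hP.source_mem i⟩
    ⟨by simp, hP.target_mem i⟩ one_pos)
  rintro a b ⟨ha, hb, hab, h⟩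
  exact ⟨ha.1.1, hb.1.2, hab, ha.2, hb.2, fun t ht htP =>
    h t ht ⟨⟨ha.1.1.trans ht.1.le, ht.2.le.trans hb.1.2⟩, htP⟩⟩

/-- An open cell of `α i` avoids the frontier points, so once it meets the image of `α j` it stays
inside. Pulled back by the embedding `α j` it becomes an interval of parameters containing `t`,
which cannot reach `a'` or `b'`, since these are mapped into `P` and the open cell avoids `P`. -/
theorem IsNodeSet.image_subset_image (hα : ∀ i, IsAnalyticArc d (α i) 0 1) (hP : IsNodeSet α P)
    {i j : ι} {a b a' b' s t : ℝ} (hi : IsCell (α i) P a b) (hj : IsCell (α j) P a' b')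
    (hs : s ∈ Ioo a b) (ht : t ∈ Ioo a' b') (hst : α i s = α j t) :
    α i '' Ioo a b ⊆ α j '' Ioo a' b' := by
  have h1 : Ioo a b ⊆ α i ⁻¹' (α j '' Icc 0 1) := by
    refine subset_of_disjoint_frontier isPreconnected_Ioo ?_ ⟨s, hs, t, ?_, hst.symm⟩
    · rw [disjoint_left]
      exact fun r hr hr' => hi.notMem r hr (hP.frontier_mem i j r ⟨hi.mem_Ioo hr, hr'⟩)
    · exact Ioo_subset_Icc_self (hj.mem_Ioo ht)
  set T : Set (Ioo (0 : ℝ) 1) := {r | α j r ∈ α i '' Ioo a b} with hT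
  have himage : (Ioo (0 : ℝ) 1).domRestrict (α j) '' T = α i '' Ioo a b := by
    ext z
    constructor
    · rintro ⟨r, hr, rfl⟩; exact hr
    · rintro ⟨r, hr, rfl⟩
      obtain ⟨r', hr', heq⟩ := h1 hr
      have hP0 := hi.notMem r hr
      have h0 : r' ∈ Ioo (0 : ℝ) 1 := by
        refine ⟨lt_of_le_of_ne hr'.1 ?_, lt_of_le_of_ne hr'.2 ?_⟩
        · rintro rfl; exact hP0 (heq ▸ hP.source_mem j)
        · rintro rfl; exact hP0 (heq ▸ hP.target_mem j)
      refine ⟨⟨r', h0⟩, ?_, heq⟩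
      change α j r' ∈ α i '' Ioo a b
      rw [heq]; exact mem_image_of_mem _ hr
  have hcont : ContinuousOn (α i) (Ioo a b) :=
    (hα i).analytic.continuousOn.mono fun r hr => Ioo_subset_Icc_self (hi.mem_Ioo hr)
  have hpre : _root_.IsPreconnected T := by
    rw [← (hα j).embedding.isInducing.isPreconnected_image, himage]
    exact isPreconnected_Ioo.image _ hcont
  have hord : OrdConnected (Subtype.val '' T) :=
    (hpre.image _ continuous_subtype_val.continuousOn).ordConnected
  have htT : t ∈ Subtype.val '' T :=
    ⟨⟨t, hj.mem_Ioo ht⟩, by rw [hT]; exact ⟨s, hs, hst⟩, rfl⟩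
  have hnot : ∀ r, α j r ∈ P → r ∉ Subtype.val '' T := by
    rintro r hr ⟨r', ⟨q, hq, hqr⟩, rfl⟩
    exact hi.notMem q hq (hqr ▸ hr)
  rw [← himage]
  rintro _ ⟨r, hr, rfl⟩
  have hrT : r.1 ∈ Subtype.val '' T := mem_image_of_mem _ hr
  refine ⟨r, ⟨?_, ?_⟩, rfl⟩
  · by_contra hle
    exact hnot a' hj.left_mem (hord.out hrT htT ⟨not_lt.1 hle, ht.1.le⟩)
  · by_contra hle
    exact hnot b' hj.right_mem (hord.out htT hrT ⟨ht.2.le, not_lt.1 hle⟩)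

theorem IsNodeSet.image_eq_image (hα : ∀ i, IsAnalyticArc d (α i) 0 1) (hP : IsNodeSet α P)
    {i j : ι} {a b a' b' : ℝ} (hi : IsCell (α i) P a b) (hj : IsCell (α j) P a' b')
    (h : (α i '' Ioo a b ∩ α j '' Ioo a' b').Nonempty) :
    α i '' Ioo a b = α j '' Ioo a' b' := by
  obtain ⟨z, ⟨s, hs, hsz⟩, ⟨t, ht, htz⟩⟩ := h
  exact (hP.image_subset_image hα hi hj hs ht (hsz.trans htz.symm)).antisymm
    (hP.image_subset_image hα hj hi ht hs (htz.trans hsz.symm))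

/-- Finitely many edges are products of the edges of an independent set. -/
theorem exists_isIndependent [T2Space M] [Finite ι] {x y : ι → M} (c : ∀ i, Curve d (x i) (y i))
    (hc : ∀ i, IsAnalyticArc d (c i).1.extend 0 1) :
    ∃ (n : ℕ) (e : Fin n → ArrowOf (PathGroupoid d M)), IsIndependent e ∧
      ∀ i, (c i).toPath ∈ (generatedBy e).arrows (x i) (y i) := by
  obtain ⟨P, hP⟩ := exists_isNodeSet hc
  have hpiece : ∀ i a b, IsCell (c i).1.extend P a b →
      0 ≤ a ∧ a < b ∧ b ≤ 1 ∧ IsPiece d (c i).1.extend a b := fun i a b h =>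
    ⟨h.nonneg, h.lt, h.le_one, Or.inl ((hc i).restrict h.nonneg h.le_one)⟩
  -- All cells of all arcs. There are finitely many, since each arc meets the finite set `P` at
  -- finitely many parameters.
  set K := {k : ι × ℝ × ℝ // IsCell (c k.1).1.extend P k.2.1 k.2.2}
  have hK : Finite K := by
    have hfin : (⋃ i, {k : ι × ℝ × ℝ | k.1 = i ∧
        k.2.1 ∈ {t | t ∈ Icc (0 : ℝ) 1 ∧ (c i).1.extend t ∈ P} ∧
        k.2.2 ∈ {t | t ∈ Icc (0 : ℝ) 1 ∧ (c i).1.extend t ∈ P}}).Finite := by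
      refine finite_iUnion fun i => ?_
      have h1 := (hc i).finite_preimage hP.finite
      exact ((finite_singleton i).prod (h1.prod h1)).subset fun k hk => ⟨hk.1, hk.2.1, hk.2.2⟩
    refine Set.Finite.to_subtype (s := {k : ι × ℝ × ℝ | IsCell (c k.1).1.extend P k.2.1 k.2.2})
      (hfin.subset fun k (hk : IsCell _ _ _ _) => mem_iUnion.2 ⟨k.1, rfl, ?_, ?_⟩)
    · exact ⟨⟨hk.nonneg, hk.lt.le.trans hk.le_one⟩, hk.left_mem⟩
    · exact ⟨⟨hk.nonneg.trans hk.lt.le, hk.le_one⟩, hk.right_mem⟩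
  set img : K → Set M := fun k => (c k.1.1).1.extend '' Ioo k.1.2.1 k.1.2.2
  obtain ⟨n, ⟨f⟩⟩ := Finite.exists_equiv_fin (range img)
  choose rep hrep using fun q : range img => q.2
  -- One cell is kept for each open image.
  let κ : Fin n → K := fun l => rep (f.symm l)
  have hκ : ∀ k : K, ∃ l, img (κ l) = img k := fun k =>
    ⟨f ⟨img k, mem_range_self k⟩, by simp [κ, hrep]⟩
  have hκinj : ∀ l l', img (κ l) = img (κ l') → l = l' := by
    intro l l' h
    simp only [κ, hrep] at h
    exact f.symm.injective (Subtype.ext h)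
  have hcell : ∀ k : K, IsCell (c k.1.1).1.extend P k.1.2.1 k.1.2.2 := fun k => k.2
  let seg : ∀ k : K, Curve d ((c k.1.1).1.extend k.1.2.1) ((c k.1.1).1.extend k.1.2.2) :=
    fun k => (c k.1.1).segment _ _ (.single (hpiece _ _ _ (hcell k)))
  have hseg : ∀ k, IsAnalyticArc d (seg k).1.extend 0 1 := fun k =>
    (c k.1.1).isAnalyticArc_segment (hcell k).lt
      ((hc k.1.1).restrict (hcell k).nonneg (hcell k).le_one) _
  have hsegimg : ∀ k, (seg k).1.extend '' Ioo 0 1 = img k := fun k =>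
    (c k.1.1).image_segment_Ioo (hcell k).lt _
  let e : Fin n → ArrowOf (PathGroupoid d M) := fun l => ⟨_, _, (seg (κ l)).toPath⟩
  refine ⟨n, e, ⟨fun l => seg (κ l), fun l => ⟨hseg _, rfl⟩, ?_⟩, fun i => ?_⟩
  -- A common point in the open cell of `l` is impossible: distinct representatives have disjoint
  -- open images, and endpoints of cells lie in `P`, which open cells avoid.
  · rintro l l' hne z ⟨hz, hz'⟩
    have h1 := (c (κ l).1.1).range_segment (hcell (κ l)).lt _ hz
    have h2 := (c (κ l').1.1).range_segment (hcell (κ l')).lt _ hz'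
    rcases h1 with h1 | h1
    · exfalso
      rcases h2 with h2 | h2
      · exact hne (hκinj _ _ (hP.image_eq_image hc (hcell _) (hcell _) ⟨z, h1, h2⟩))
      · obtain ⟨t, ht, rfl⟩ := h1
        refine (hcell (κ l)).notMem t ht ?_
        rcases h2 with h2 | h2
        · rw [h2]; exact (hcell _).left_mem
        · rw [mem_singleton_iff.1 h2]; exact (hcell _).right_mem
    · exact h1
  · refine (c i).toPath_mem_of_chain (hpiece i) (fun a b h => ?_) (hP.transGen_isCell hc i)
    let k : K := ⟨(i, a, b), h⟩
    obtain ⟨l, hl⟩ := hκ k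
    refine Curve.toPath_mem_of_image_eq (seg (κ l)) (seg k) (hseg _) (hseg _) ?_
      (mem_generatedBy e l)
    rw [hsegimg, hsegimg, hl]

end Cells

/-! ### Directedness of the set of tame subgroupoids. -/

section Directed

variable {d : ℕ} {M : Type u} [TopologicalSpace M] [ChartedSpace (EuclideanSpace ℝ (Fin d)) M]

/-- The set of tame subgroupoids is directed. -/
theorem TameSubgroupoid.exists_le [T2Space M] (L₁ L₂ : TameSubgroupoid d M) :
    ∃ L : TameSubgroupoid d M, L₁.1 ≤ L.1 ∧ L₂.1 ≤ L.1 := by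
  obtain ⟨L₁, n₁, e₁, ⟨c₁, h₁, -⟩, rfl⟩ := L₁
  obtain ⟨L₂, n₂, e₂, ⟨c₂, h₂, -⟩, rfl⟩ := L₂
  -- The two generating sets together need not be independent; cutting their edges into cells
  -- restores independence.
  obtain ⟨n, e, he, hmem⟩ := exists_isIndependent (ι := Fin n₁ ⊕ Fin n₂)
    (x := Sum.elim (fun i => (show M from (e₁ i).src)) fun i => (e₂ i).src)
    (y := Sum.elim (fun i => (show M from (e₁ i).tgt)) fun i => (e₂ i).tgt)
    (fun i => match i with
      | .inl i => c₁ i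
      | .inr i => c₂ i)
    (by
      rintro (i | i)
      · exact (h₁ i).1
      · exact (h₂ i).1)
  refine ⟨⟨generatedBy e, n, e, he, rfl⟩, generatedBy_le fun i => ?_, generatedBy_le fun i => ?_⟩
  · rw [← (h₁ i).2]; exact hmem (.inl i)
  · rw [← (h₂ i).2]; exact hmem (.inr i)

end Directed

/-! ### The algebras of cylindrical functions and their density. -/

section Cylindrical

variable {d : ℕ} {M : Type u} [TopologicalSpace M] [ChartedSpace (EuclideanSpace ℝ (Fin d)) M]
  {G : Type v} [Group G] [TopologicalSpace G]

/-- `f` is a `C^k` function of the evaluations at the edges `e`. -/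
def IsCkFor (m : ℕ) [ChartedSpace (EuclideanSpace ℝ (Fin m)) G] (k : ℕ∞) (L : TameSubgroupoid d M)
    {n : ℕ} (e : Fin n → ArrowOf (PathGroupoid d M)) (hL : L.1 = generatedBy e)
    (f : C(ConnectionsOn L G, ℂ)) : Prop :=
  ∃ F : (Fin n → G) → ℂ,
    ContMDiff (ModelWithCorners.pi fun _ : Fin n => 𝓡 m) 𝓘(ℝ, ℂ) k F ∧ ∀ A, f A = F (rho L e hL A)

section Smooth

variable {m : ℕ} [ChartedSpace (EuclideanSpace ℝ (Fin m)) G] {k : ℕ∞}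

/-- Composition with the smooth words of `exists_word` rewrites `f` in terms of the larger
generating set. That set is prescribed, so that two functions can be expressed through the same
edges. -/
theorem IsCk.comp_restrictOfLE [LieGroup (𝓡 m) ∞ G] {L L' : TameSubgroupoid d M}
    (h : L.1 ≤ L'.1) {f : C(ConnectionsOn L G, ℂ)} (hf : IsCk (m := m) k L f) {n : ℕ}
    (e : Fin n → ArrowOf (PathGroupoid d M)) (hL : L'.1 = generatedBy e) :
    IsCkFor m k L' e hL (f.comp (restrictOfLE h)) := by
  obtain ⟨n', e', -, hL', F, hF, hfF⟩ := hf
  have hmem : ∀ i, (e' i).hom ∈ L'.1.arrows (e' i).src (e' i).tgt := fun i =>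
    (Subgroupoid.le_iff _ _).1 h (hL' ▸ mem_generatedBy e' i)
  choose W hW hWe using fun i => exists_word (G := G) (m := m) e hL (hmem i)
  refine ⟨fun g => F fun i => W i g, hF.comp (contMDiff_pi fun i => (hW i).of_le ?_), fun A => ?_⟩
  · exact_mod_cast le_top
  · refine (hfF _).trans ?_
    congr 1
    funext i
    exact hWe i A

theorem exists_isCkFor_of_mem_cylK [LieGroup (𝓡 m) ∞ G] [T2Space M]
    {f g : C(GeneralizedConnections d M G, ℂ)} (hf : f ∈ CylK d M m G k)
    (hg : g ∈ CylK d M m G k) :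
    ∃ (L : TameSubgroupoid d M) (n : ℕ) (e : Fin n → ArrowOf (PathGroupoid d M))
      (_ : IsIndependent e) (hL : L.1 = generatedBy e) (f' g' : C(ConnectionsOn L G, ℂ)),
      IsCkFor m k L e hL f' ∧ IsCkFor m k L e hL g' ∧ pullback G L f' = f ∧
        pullback G L g' = g := by
  obtain ⟨L₁, f', hf', rfl⟩ := Set.mem_iUnion.1 hf
  obtain ⟨L₂, g', hg', rfl⟩ := Set.mem_iUnion.1 hg
  obtain ⟨L, h₁, h₂⟩ := TameSubgroupoid.exists_le L₁ L₂
  obtain ⟨n, e, he, hL⟩ := L.2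
  exact ⟨L, n, e, he, hL, _, _, IsCk.comp_restrictOfLE h₁ hf' e hL,
    IsCk.comp_restrictOfLE h₂ hg' e hL, rfl, rfl⟩

theorem IsCkFor.pullback_mem {L : TameSubgroupoid d M} {n : ℕ}
    {e : Fin n → ArrowOf (PathGroupoid d M)} (he : IsIndependent e) {hL : L.1 = generatedBy e}
    {f : C(ConnectionsOn L G, ℂ)} (hf : IsCkFor m k L e hL f) :
    pullback G L f ∈ CylK d M m G k := by
  obtain ⟨F, hF, h⟩ := hf
  exact Set.mem_iUnion.2 ⟨L, f, ⟨n, e, he, hL, F, hF, h⟩, rfl⟩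

end Smooth

theorem isIndependent_empty : IsIndependent (Fin.elim0 : Fin 0 → ArrowOf (PathGroupoid d M)) :=
  ⟨fun i => i.elim0, fun i => i.elim0, fun i => i.elim0⟩

theorem isIndependent_singleton {x y : M} (c : Curve d x y)
    (hc : IsAnalyticArc d c.1.extend 0 1) :
    IsIndependent (fun _ : Fin 1 => (⟨x, y, c.toPath⟩ : ArrowOf (PathGroupoid d M))) :=
  ⟨fun _ => c, fun _ => ⟨hc, rfl⟩, fun i j hij => absurd (Subsingleton.elim i j) hij⟩

/-- The `C^k` cylindrical functions form a unital `*`-algebra. -/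
def cylKSubalgebra (d : ℕ) (M : Type u) [TopologicalSpace M]
    [ChartedSpace (EuclideanSpace ℝ (Fin d)) M] [T2Space M] (m : ℕ) (G : Type v) [Group G]
    [TopologicalSpace G] [ChartedSpace (EuclideanSpace ℝ (Fin m)) G] [LieGroup (𝓡 m) ∞ G]
    (k : ℕ∞) : StarSubalgebra ℂ C(GeneralizedConnections d M G, ℂ) where
  carrier := CylK d M m G k
  mul_mem' := by
    intro f g hf hg
    obtain ⟨L, n, e, he, hL, f', g', ⟨F, hF, hfF⟩, ⟨F', hF', hgF⟩, rfl, rfl⟩ :=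
      exists_isCkFor_of_mem_cylK hf hg
    rw [← map_mul]
    refine IsCkFor.pullback_mem (e := e) (hL := hL) he ⟨fun x => F x * F' x, ?_, fun A => ?_⟩
    · exact (contDiff_fst.mul contDiff_snd).contMDiff.comp (hF.prodMk_space hF')
    · rw [ContinuousMap.mul_apply, hfF, hgF]
  add_mem' := by
    intro f g hf hg
    obtain ⟨L, n, e, he, hL, f', g', ⟨F, hF, hfF⟩, ⟨F', hF', hgF⟩, rfl, rfl⟩ :=
      exists_isCkFor_of_mem_cylK hf hg
    rw [← map_add]
    refine IsCkFor.pullback_mem (e := e) (hL := hL) he ⟨fun x => F x + F' x, hF.add hF',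
      fun A => ?_⟩
    rw [ContinuousMap.add_apply, hfF, hgF]
  algebraMap_mem' := by
    intro r
    -- Constants are functions of no edges at all: they come from the subgroupoid generated by the
    -- empty set.
    have h := (pullback G (⟨generatedBy Fin.elim0, 0, Fin.elim0, isIndependent_empty, rfl⟩ :
      TameSubgroupoid d M)).toAlgHom.commutes r
    rw [← h]
    exact IsCkFor.pullback_mem (e := Fin.elim0) (hL := rfl) isIndependent_empty
      ⟨fun _ => r, contMDiff_const, fun A => rfl⟩
  star_mem' := by
    intro f hf
    obtain ⟨L, n, e, he, hL, f', -, ⟨F, hF, hfF⟩, -, rfl, -⟩ := exists_isCkFor_of_mem_cylK hf hf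
    rw [← map_star]
    refine IsCkFor.pullback_mem (e := e) (hL := hL) he ⟨fun x => star (F x), ?_, fun A => ?_⟩
    · exact (Complex.conjCLE.contDiff (n := k)).contMDiff.comp hF
    · rw [ContinuousMap.star_apply, hfF]

theorem exists_pullback_of_mem_cyl [T2Space M] {f g : C(GeneralizedConnections d M G, ℂ)}
    (hf : f ∈ Cyl d M G) (hg : g ∈ Cyl d M G) :
    ∃ (L : TameSubgroupoid d M) (f' g' : C(ConnectionsOn L G, ℂ)),
      pullback G L f' = f ∧ pullback G L g' = g := by
  obtain ⟨L₁, f', rfl⟩ := Set.mem_iUnion.1 hf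
  obtain ⟨L₂, g', rfl⟩ := Set.mem_iUnion.1 hg
  obtain ⟨L, h₁, h₂⟩ := TameSubgroupoid.exists_le L₁ L₂
  exact ⟨L, f'.comp (restrictOfLE h₁), g'.comp (restrictOfLE h₂), rfl, rfl⟩

theorem pullback_mem_cyl (L : TameSubgroupoid d M) (f : C(ConnectionsOn L G, ℂ)) :
    pullback G L f ∈ Cyl d M G :=
  Set.mem_iUnion.2 ⟨L, f, rfl⟩

theorem cylK_subset_cyl {m : ℕ} [ChartedSpace (EuclideanSpace ℝ (Fin m)) G] {k : ℕ∞} :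
    CylK d M m G k ⊆ Cyl d M G := by
  intro f hf
  obtain ⟨L, f', -, rfl⟩ := Set.mem_iUnion.1 hf
  exact pullback_mem_cyl L f'

/-- The cylindrical functions form a unital `*`-algebra. -/
def cylSubalgebra (d : ℕ) (M : Type u) [TopologicalSpace M]
    [ChartedSpace (EuclideanSpace ℝ (Fin d)) M] [T2Space M] (G : Type v) [Group G]
    [TopologicalSpace G] : StarSubalgebra ℂ C(GeneralizedConnections d M G, ℂ) where
  carrier := Cyl d M G
  mul_mem' := by
    intro f g hf hg
    obtain ⟨L, f', g', rfl, rfl⟩ := exists_pullback_of_mem_cyl hf hg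
    rw [← map_mul]
    exact pullback_mem_cyl L _
  add_mem' := by
    intro f g hf hg
    obtain ⟨L, f', g', rfl, rfl⟩ := exists_pullback_of_mem_cyl hf hg
    rw [← map_add]
    exact pullback_mem_cyl L _
  algebraMap_mem' := by
    intro r
    have h := (pullback G (⟨generatedBy Fin.elim0, 0, Fin.elim0, isIndependent_empty, rfl⟩ :
      TameSubgroupoid d M)).toAlgHom.commutes r
    rw [← h]
    exact pullback_mem_cyl _ _
  star_mem' := by
    intro f hf
    obtain ⟨L, f', -, rfl, -⟩ := exists_pullback_of_mem_cyl hf hf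
    rw [← map_star]
    exact pullback_mem_cyl L _

/-- The arrows at which two morphisms agree. -/
def eqSubgroupoid {C : Type u} [Groupoid C] (A B : GroupoidHom C G) : Subgroupoid C where
  arrows _ _ := {p | A.eval p = B.eval p}
  inv := by
    intro x y p (hp : A.eval p = B.eval p)
    change A.eval _ = B.eval _
    rw [A.eval_inv, B.eval_inv, hp]
  mul := by
    intro x y z p (hp : A.eval p = B.eval p) q (hq : A.eval q = B.eval q)
    change A.eval _ = B.eval _
    rw [A.eval_comp, B.eval_comp, hp, hq]

/-- Generalized connections are determined by their values at edges. -/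
theorem exists_edge_eval_ne {H : Type v} [Group H] {A B : GeneralizedConnections d M H} (h : A ≠ B) :
    ∃ (x y : M) (c : Curve d x y), IsAnalyticArc d c.1.extend 0 1 ∧
      A.eval c.toPath ≠ B.eval c.toPath := by
  by_contra! hc
  refine h (GroupoidHom.ext fun x y p => ?_)
  obtain ⟨c, rfl⟩ := Quotient.exists_rep p
  -- The arrows at which `A` and `B` agree form a subgroupoid; if it contains all edges it contains
  -- all paths.
  exact Curve.toPath_mem_of_edges (L := eqSubgroupoid A B)
    (fun x => (A.eval_id x).trans (B.eval_id x).symm) (fun x y c hcc => hc x y c hcc) c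

theorem exists_contMDiff_ne {N : Type*} [TopologicalSpace N] {m : ℕ}
    [ChartedSpace (EuclideanSpace ℝ (Fin m)) N] [IsManifold (𝓡 m) ∞ N] [T2Space N] [CompactSpace N]
    {a b : N} (h : a ≠ b) :
    ∃ f : N → ℂ, ContMDiff (𝓡 m) 𝓘(ℝ, ℂ) ∞ f ∧ f a ≠ f b := by
  obtain ⟨f, hf0, hf1, -⟩ := exists_contMDiffMap_zero_one_of_isClosed (n := ⊤) (𝓡 m)
    (isClosed_singleton (x := a)) (isClosed_singleton (x := b)) (by simpa using h)
  refine ⟨fun x => (f x : ℂ), (Complex.ofRealCLM.contDiff (n := ∞)).contMDiff.comp f.contMDiff, ?_⟩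
  have h0 : f a = 0 := hf0 rfl
  have h1 : f b = 1 := hf1 rfl
  simp [h0, h1]

/-- Two distinct connections differ at an edge, which alone is an independent set; a smooth function
on `G` separating the two values gives the cylindrical function. -/
theorem cylKSubalgebra_separatesPoints [T2Space M] {m : ℕ}
    [ChartedSpace (EuclideanSpace ℝ (Fin m)) G] [LieGroup (𝓡 m) ∞ G] [T2Space G] [CompactSpace G]
    (k : ℕ∞) : (cylKSubalgebra d M m G k).SeparatesPoints := by
  intro A B hAB
  obtain ⟨x, y, c, hc, hne⟩ := exists_edge_eval_ne hAB
  have : IsManifold (𝓡 m) ∞ G := inferInstance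
  obtain ⟨f, hf, hfne⟩ := exists_contMDiff_ne (m := m) hne
  set e : Fin 1 → ArrowOf (PathGroupoid d M) := fun _ => ⟨x, y, c.toPath⟩
  have he : IsIndependent e := isIndependent_singleton c hc
  let L : TameSubgroupoid d M := ⟨generatedBy e, 1, e, he, rfl⟩
  let f' : C(ConnectionsOn L G, ℂ) := ⟨fun A => f (A.evalMem (e 0).hom (mem_generatedBy e 0)),
    hf.continuous.comp (GroupoidHom.continuous_evalMem _ _)⟩
  have hf' : IsCkFor m k L e rfl f' := by
    refine ⟨fun g => f (g 0), (hf.of_le ?_).comp (contMDiff_pi_apply _ 0), fun A => rfl⟩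
    exact_mod_cast le_top
  exact ⟨_, ⟨pullback G L f', hf'.pullback_mem he, rfl⟩, hfne⟩

/-- The Stone–Weierstrass theorem on the compact space `Ā`. -/
theorem exists_mem_cylK_norm_sub_le [T2Space M] {m : ℕ}
    [ChartedSpace (EuclideanSpace ℝ (Fin m)) G] [LieGroup (𝓡 m) ∞ G] [T2Space G] [CompactSpace G]
    (k : ℕ∞) (f : C(GeneralizedConnections d M G, ℂ)) (ε : ℝ) (hε : 0 < ε) :
    ∃ g ∈ CylK d M m G k, ∀ A, ‖f A - g A‖ ≤ ε := by
  have : IsTopologicalGroup G := topologicalGroup_of_lieGroup (𝓡 m) ∞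
  have : CompactSpace (GeneralizedConnections d M G) := GroupoidHom.compactSpace
  have h := ContinuousMap.starSubalgebra_topologicalClosure_eq_top_of_separatesPoints
    (cylKSubalgebra d M m G k) (cylKSubalgebra_separatesPoints k)
  have hf : f ∈ closure (cylKSubalgebra d M m G k : Set C(GeneralizedConnections d M G, ℂ)) := by
    rw [← StarSubalgebra.topologicalClosure_coe, h]
    trivial
  obtain ⟨g, hg, hfg⟩ := Metric.mem_closure_iff.1 hf ε hε
  refine ⟨g, hg, fun A => ?_⟩
  rw [← dist_eq_norm]
  exact (ContinuousMap.dist_apply_le_dist A).trans hfg.le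

end Cylindrical

end GenConn

end

theorem proposition2p2
    {d : ℕ} {M : Type*} [TopologicalSpace M] [ChartedSpace (EuclideanSpace ℝ (Fin d)) M]
    [IsManifold (𝓡 d) ω M] [T2Space M] [ParacompactSpace M] [ConnectedSpace M]
    {m : ℕ} {G : Type*} [Group G] [TopologicalSpace G]
    [ChartedSpace (EuclideanSpace ℝ (Fin m)) G] [LieGroup (𝓡 m) ∞ G]
    [T2Space G] [CompactSpace G] [ConnectedSpace G] :
    ∃ S : StarSubalgebra ℂ C(GenConn.GeneralizedConnections d M G, ℂ),
      (S : Set C(GenConn.GeneralizedConnections d M G, ℂ)) = GenConn.Cyl d M G ∧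
      (∀ (f : C(GenConn.GeneralizedConnections d M G, ℂ)) (ε : ℝ), 0 < ε →
        ∃ g ∈ GenConn.Cyl d M G, ∀ A, ‖f A - g A‖ ≤ ε) ∧
      ∀ k : ℕ∞, 1 ≤ k →
        ∃ Sk : StarSubalgebra ℂ C(GenConn.GeneralizedConnections d M G, ℂ), Sk ≤ S ∧
          (Sk : Set C(GenConn.GeneralizedConnections d M G, ℂ)) = GenConn.CylK d M m G k ∧
          (∀ (f : C(GenConn.GeneralizedConnections d M G, ℂ)) (ε : ℝ), 0 < ε →
            ∃ g ∈ GenConn.CylK d M m G k, ∀ A, ‖f A - g A‖ ≤ ε) := by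
  refine ⟨GenConn.cylSubalgebra d M G, rfl, fun f ε hε => ?_, fun k _ =>
    ⟨GenConn.cylKSubalgebra d M m G k, GenConn.cylK_subset_cyl, rfl,
      GenConn.exists_mem_cylK_norm_sub_le k⟩⟩
  -- The larger set `Cyl` inherits density from any `Cyl^k`; here `k = 1`.
  obtain ⟨g, hg, h⟩ := GenConn.exists_mem_cylK_norm_sub_le (m := m) 1 f ε hε
  exact ⟨g, GenConn.cylK_subset_cyl hg, h⟩
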